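/- Let $\mu>0$, $w\in\mathbb R\setminus\{0\}$ and $0<\kappa<1$. Put $c_2(\kappa)=\bigl(2\Gamma(\kappa)\cos(\kappa\pi/2)\bigr)^{-1}$ and, for $u\ge 0$, $$\theta_\kappa(u)=\frac{\Gamma(\frac{\kappa+1}{2})}{\Gamma(\frac{3-\kappa}{2})}\Bigl(\frac u2\Bigr)^{1-\kappa} +\Gamma\Bigl(\frac{\kappa+1}{2}\Bigr)\sum_{m\ge1}\frac{(u/2)^{2m+1-\kappa}}{m!\,\Gamma(m-\frac{\kappa-1}{2}+1)} -\Gamma\Bigl(\frac{\kappa+1}{2}\Bigr)\sum_{m\ge1}\frac{(u/2)^{2m}}{m!\,\Gamma(m+\frac{\kappa-1}{2}+1)},$$ $$f_{\kappa,w}(\lambda)=\frac{c_2(\kappa)}2\left(\frac{1-\theta_\kappa(|\lambda+w|)}{|\lambda+w|^{1-\kappa}}+\frac{1-\theta_\kappa(|\lambda-w|)}{|\lambda-w|^{1-\kappa}}\right).$$ A complex Gaussian random measure with control measure $F$ on $\mathbb R$ is a centred jointly Gaussian additive family $Z(A)$, indexed by the Borel sets $A$ with $F(A)<\infty$, such that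 $\mathbb E\,Z(A)\overline{Z(B)}=F(A\cap B)$ and $Z(-A)=\overline{Z(A)}$ almost surely; integrals $\int g\,dZ$, $g\in L^2(F)$, are mean-square limits of integrals of simple functions. Complex white noise is the case in which $F$ is Lebesgue measure. Let $\eta(x)=\int_{\mathbb R}e^{i\lambda x}Z(d\lambda)$, $x\in\mathbb R$, be a real stationary zero-mean Gaussian process, where $Z$ is a complex Gaussian random measure with a finite control measure $F$, and suppose that $$\mathrm{Cov}(\eta(0),\eta(x))=\frac{\cos(wx)}{(1+x^2)^{\kappa/2}},\qquad x\in\mathbb R .$$ Let $$u(t,x)=\int_{\mathbb R}e^{i\lambda x-\mu\lambda^2t}\,Z(d\lambda),\qquad t>0,\ x\in\mathbb R,$$ be the solution of the heat equation $\partial u/\partial t=\mu\,\partial^2u/\partial x^2$ with initial condition $\eta$; it is real almost surely, and if $\eta$ is jointly measurable then for all $t>0$ and $x\in\mathbb R$, almost surely, $u(t,x)=(4\pi\mu t)^{-1/2}\int_{\mathbb R}\eta(y)e^{-(x-y)^2/(4\mu t)}dy$, the integral converging absolutely. For $\varepsilon>0$ let $U_\varepsilon(t,x)=\varepsilon^{-1/4}u(t/\varepsilon,x/\sqrt\varepsilon)$.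 Let $W$ be a complex white noise on $\mathbb R$ (possibly on another probability space) and, for $t>0$ and $x\in\mathbb R$, $$U_0(t,x)=\sqrt{\frac{c_2(\kappa)}{|w|^{1-\kappa}}\bigl(1-\theta_\kappa(|w|)\bigr)}\int_{\mathbb R}e^{i\lambda x-\mu t\lambda^2}\,W(d\lambda).$$ Then: 1. $U_0$ is almost surely real, and it is a zero-mean Gaussian random field with $$\mathrm{Cov}(U_0(t,x),U_0(t',x'))=\frac{c_2(\kappa)\sqrt\pi\,(1-\theta_\kappa(|w|))}{\sqrt\mu\,|w|^{1-\kappa}}\cdot\frac{e^{-\frac{(x-x')^2}{4\mu(t+t')}}}{\sqrt{t+t'}},\qquad t,t'>0,\ x,x'\in\mathbb R.$$ 2. As $\varepsilon\to0$, the finite-dimensional distributions of $U_\varepsilon$ on $(0,\infty)\times\mathbb R$ converge weakly to those of $U_0$. 3. For every $\varepsilon>0$ the field $V_\varepsilon(t,x)=\int_{\mathbb R}e^{i\lambda x-\mu\lambda^2t}\sqrt{f_{\kappa,w}(\lambda\sqrt\varepsilon)}\,W(d\lambda)$ is almost surely real and has the same finite-dimensional distributions as $U_\varepsilon$, and $\mathbb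 E|V_\varepsilon(t,x)-U_0(t,x)|^2\to0$ as $\varepsilon\to0$ for all $t>0$, $x\in\mathbb R$. 4. $U_0$ is stationary in space but not stationary in time. -/

import Mathlib

open MeasureTheory ProbabilityTheory Filter Topology
open scoped ENNReal

noncomputable section

/-! ### The constants and the spectral density -/

/-- `c₂(κ) = 1 / (2 Γ(κ) cos(κπ/2))`. -/
def cTwo (κ : ℝ) : ℝ := (2 * Real.Gamma κ * Real.cos (κ * Real.pi / 2))⁻¹

/-- The function `θ_κ(u)`, `u ≥ 0`, given by its series. The two series run over `m ≥ 1`, which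
is indexed here by `m = k + 1`, `k : ℕ`. -/
def theta (κ u : ℝ) : ℝ :=
  Real.Gamma ((κ + 1) / 2) / Real.Gamma ((3 - κ) / 2) * (u / 2) ^ (1 - κ)
    + Real.Gamma ((κ + 1) / 2) * ∑' k : ℕ,
        (u / 2) ^ (2 * ((k : ℝ) + 1) + 1 - κ) /
          ((k + 1).factorial * Real.Gamma ((k : ℝ) + 1 - (κ - 1) / 2 + 1))
    - Real.Gamma ((κ + 1) / 2) * ∑' k : ℕ,
        (u / 2) ^ (2 * (k + 1)) /
          ((k + 1).factorial * Real.Gamma ((k : ℝ) + 1 + (κ - 1) / 2 + 1))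

/-- The spectral density `f_{κ,w}`. -/
def specDensity (κ w l : ℝ) : ℝ :=
  cTwo κ / 2 * ((1 - theta κ |l + w|) / |l + w| ^ (1 - κ)
    + (1 - theta κ |l - w|) / |l - w| ^ (1 - κ))

/-! ### Complex Gaussian random measures and their stochastic integral -/

variable {Ω Ω' : Type*} [MeasurableSpace Ω] [MeasurableSpace Ω']

/-- `Z` is a complex (Hermitian) centred Gaussian orthogonal random measure on `ℝ` with control
measure `F`, i.e. `E |Z(dl)|² = F(dl)` and `Z(-A) = conj Z(A)`. It is defined on the Borel sets of
finite `F`-measure; its values on other sets play no role. -/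
structure IsGaussianRandomMeasure (F : Measure ℝ) (Z : Set ℝ → Ω → ℂ) (P : Measure Ω) :
    Prop where
  gaussian : IsGaussianProcess (fun A : {A : Set ℝ // MeasurableSet A ∧ F A < ∞} => Z A) P
  mean_zero : ∀ A, MeasurableSet A → F A < ∞ → ∫ ω, Z A ω ∂P = 0
  covariance : ∀ A B, MeasurableSet A → F A < ∞ → MeasurableSet B → F B < ∞ →
    ∫ ω, Z A ω * (starRingEnd ℂ) (Z B ω) ∂P = ((F (A ∩ B)).toReal : ℂ)
  additive : ∀ A B, MeasurableSet A → F A < ∞ → MeasurableSet B → F B < ∞ → Disjoint A B →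
    ∀ᵐ ω ∂P, Z (A ∪ B) ω = Z A ω + Z B ω
  hermitian : ∀ A, MeasurableSet A → F A < ∞ →
    ∀ᵐ ω ∂P, Z (Neg.neg ⁻¹' A) ω = (starRingEnd ℂ) (Z A ω)

/-- Complex (Hermitian) Gaussian white noise on `ℝ`: the control measure is Lebesgue measure. -/
def IsWhiteNoise (W : Set ℝ → Ω → ℂ) (P : Measure Ω) : Prop :=
  IsGaussianRandomMeasure volume W P

/-- The stochastic integral of a simple function. (The value `0` contributes nothing.) -/
def simpleIntegral (Z : Set ℝ → Ω → ℂ) (s : SimpleFunc ℝ ℂ) (ω : Ω) : ℂ :=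
  ∑ y ∈ s.range, y * Z (s ⁻¹' {y}) ω

/-- `X` is a version of `∫ g dZ`: the mean-square limit of the integrals of simple functions
that converge to `g` in `L²(F)`. -/
def IsStochIntegral (F : Measure ℝ) (Z : Set ℝ → Ω → ℂ) (P : Measure Ω)
    (g : ℝ → ℂ) (X : Ω → ℂ) : Prop :=
  MemLp g 2 F ∧ MemLp X 2 P ∧ ∃ s : ℕ → SimpleFunc ℝ ℂ,
    (∀ n, MemLp (s n) 2 F) ∧
    Tendsto (fun n => eLpNorm (fun l => s n l - g l) 2 F) atTop (𝓝 0) ∧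
    Tendsto (fun n => eLpNorm (fun ω => simpleIntegral Z (s n) ω - X ω) 2 P) atTop (𝓝 0)

open Classical in
/-- The stochastic integral `∫ g dZ` (a chosen version; `0` if there is none). -/
def stochIntegral (F : Measure ℝ) (Z : Set ℝ → Ω → ℂ) (P : Measure Ω) (g : ℝ → ℂ) : Ω → ℂ :=
  if h : ∃ X, IsStochIntegral F Z P g X then h.choose else 0

/-! ### The random fields -/

/-- The kernel `l ↦ exp(i l x - μ t l²)`. -/
def heatKernelFourier (μ t x : ℝ) (l : ℝ) : ℂ :=
  Complex.exp (Complex.I * l * x - μ * t * l ^ 2)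

/-- The integral `∫ exp(i l x - μ l² t) Z(dl)` as a complex random variable. -/
def solutionC (F : Measure ℝ) (Z : Set ℝ → Ω → ℂ) (P : Measure Ω) (μ t x : ℝ) : Ω → ℂ :=
  stochIntegral F Z P (heatKernelFourier μ t x)

/-- The solution `u(t,x)`, as a real random field. -/
def solution (F : Measure ℝ) (Z : Set ℝ → Ω → ℂ) (P : Measure Ω) (μ t x : ℝ) (ω : Ω) : ℝ :=
  (solutionC F Z P μ t x ω).re

/-- The rescaled solution `U_ε(t,x) = ε^{-1/4} u(t/ε, x/√ε)`. -/
def rescaled (F : Measure ℝ) (Z : Set ℝ → Ω → ℂ) (P : Measure Ω) (μ ε t x : ℝ) (ω : Ω) : ℝ :=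
  ε ^ (-(1 / 4) : ℝ) * solution F Z P μ (t / ε) (x / √ε) ω

/-- The limit field `U₀(t,x)` as a complex random variable. -/
def limitFieldC (W : Set ℝ → Ω → ℂ) (P : Measure Ω) (κ w μ t x : ℝ) (ω : Ω) : ℂ :=
  (√(cTwo κ / |w| ^ (1 - κ) * (1 - theta κ |w|)) : ℝ) *
    stochIntegral volume W P (heatKernelFourier μ t x) ω

/-- The limit field `U₀(t,x)`, as a real random field. -/
def limitField (W : Set ℝ → Ω → ℂ) (P : Measure Ω) (κ w μ t x : ℝ) (ω : Ω) : ℝ :=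
  (limitFieldC W P κ w μ t x ω).re

/-- The field `∫ exp(i l x - μ l² t) √(f_{κ,w}(l √ε)) W(dl)` as a complex random variable. -/
def coupledFieldC (W : Set ℝ → Ω → ℂ) (P : Measure Ω) (κ w μ ε t x : ℝ) : Ω → ℂ :=
  stochIntegral volume W P
    (fun l => heatKernelFourier μ t x l * (√(specDensity κ w (l * √ε)) : ℝ))

/-- The same field, as a real random field. -/
def coupledField (W : Set ℝ → Ω → ℂ) (P : Measure Ω) (κ w μ ε t x : ℝ) (ω : Ω) : ℝ :=
  (coupledFieldC W P κ w μ ε t x ω).re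

/-! ### Finite-dimensional distributions of random fields on `(0,∞) × ℝ` -/

/-- The vector `(X(t₁,x₁), …, X(tₙ,xₙ))`. -/
def fieldAt (X : ℝ → ℝ → Ω → ℝ) {n : ℕ} (t x : Fin n → ℝ) (ω : Ω) : Fin n → ℝ :=
  fun i => X (t i) (x i) ω

/-- Equality of all finite-dimensional distributions. -/
def SameFdd (X : ℝ → ℝ → Ω → ℝ) (P : Measure Ω) (Y : ℝ → ℝ → Ω' → ℝ) (P' : Measure Ω') : Prop :=
  ∀ (n : ℕ) (t x : Fin n → ℝ), (∀ i, 0 < t i) →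
    IdentDistrib (fieldAt X t x) (fieldAt Y t x) P P'

/-- Weak convergence of all finite-dimensional distributions as `ε → 0`, `ε > 0`. -/
def FddTendsto (X : ℝ → ℝ → ℝ → Ω → ℝ) (P : Measure Ω) [IsProbabilityMeasure P]
    (Y : ℝ → ℝ → Ω' → ℝ) (P' : Measure Ω') [IsProbabilityMeasure P'] : Prop :=
  ∀ (n : ℕ) (t x : Fin n → ℝ), (∀ i, 0 < t i) →
    TendstoInDistribution (fun ε : Set.Ioi (0 : ℝ) => fieldAt (X ε) t x)
      (comap ((↑) : Set.Ioi (0 : ℝ) → ℝ) (𝓝 0)) (fieldAt Y t x) (fun _ => P) P'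

/-- Stationarity in the space variable. -/
def StationaryInSpace (X : ℝ → ℝ → Ω → ℝ) (P : Measure Ω) : Prop :=
  ∀ h : ℝ, SameFdd (fun t x => X t (x + h)) P X P

/-- Stationarity in the time variable. -/
def StationaryInTime (X : ℝ → ℝ → Ω → ℝ) (P : Measure Ω) : Prop :=
  ∀ h : ℝ, 0 < h → SameFdd (fun t x => X (t + h) x) P X P

end

/-!
Write `(1 + x²)^(-κ/2)` as a `Γ(κ/2)`-mixture of the Gaussian characteristic functions
`x ↦ exp(-s x²)`. This exhibits it as the Fourier transform of a Bessel kernel, and expanding the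
Bessel function `K_ν`, `ν = (1 - κ) / 2`, in terms of `I_ν` and `I_{-ν}` turns that kernel into
`c₂(κ) (1 - θ_κ(|l|)) / |l|^(1-κ)`. Multiplying by `cos (w x)` averages its translates by `±w`, so a
finite measure is determined by its characteristic function to be `F(dl) = f_{κ,w}(l) dl`.

By the Itô isometry, the substitution `l ↦ l √ε`, under which `ε^(-1/4)` makes up for the Jacobian
and the kernel `exp(i l x - μ t l²)` is invariant, shows that `U_ε` and the integral of
`exp(i l x - μ t l²) √(f(l √ε))` against white noise have the same covariance. Both are Gaussian, so
they agree in law. As `w ≠ 0`, the density `f_{κ,w}` is continuous at `0`, and dominated convergence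
gives the convergence in mean square, with `√(f_{κ,w}(0))` in the limit. The heat semigroup formula
is a stochastic Fubini theorem: the spectral integral and the Gaussian average of `η` have the same
inner product with every stochastic integral, and both lie in the closed span of these.
-/

section Bessel

open Set Real

/-- The generalised exponential integral, `y ^ (-a) * Γ(a, y)` in terms of the upper incomplete
Gamma function. -/
noncomputable def expIntegral (a y : ℝ) : ℝ :=
  ∫ r in Ioi 1, r ^ (a - 1) * exp (-(y * r))

/-- The entire part of the lower incomplete Gamma function,
`γ(a, y) = y ^ a * lowerGammaSeries a y`; meaningful only if `a` is not a non-positive integer. -/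
noncomputable def lowerGammaSeries (a y : ℝ) : ℝ :=
  ∑' k : ℕ, (-y) ^ k / (k.factorial * (a + k))

lemma integrableOn_rpow_mul_exp_neg_mul_Ioi_one (s : ℝ) {y : ℝ} (hy : 0 < y) :
    IntegrableOn (fun r : ℝ => r ^ s * exp (-(y * r))) (Ioi 1) := by
  have hdom : IntegrableOn (fun r : ℝ => r ^ |s| * exp (-y * r ^ (1 : ℝ))) (Ioi 1) :=
    (integrableOn_rpow_mul_exp_neg_mul_rpow (by linarith [abs_nonneg s]) one_pos hy).mono_set
      (Ioi_subset_Ioi zero_le_one)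
  refine hdom.mono' (by fun_prop) ?_
  filter_upwards [ae_restrict_mem measurableSet_Ioi] with r hr
  have hr0 : 0 < r := one_pos.trans hr
  rw [norm_of_nonneg (by positivity), rpow_one, neg_mul]
  gcongr
  · exact le_of_lt hr
  · exact le_abs_self s

lemma expIntegral_add_one (a : ℝ) {y : ℝ} (hy : 0 < y) :
    y * expIntegral (a + 1) y = exp (-y) + a * expIntegral a y := by
  have hint (s : ℝ) := integrableOn_rpow_mul_exp_neg_mul_Ioi_one s hy
  have hderiv : ∀ r ∈ Ioi (1 : ℝ), HasDerivAt (fun r : ℝ => r ^ a * exp (-y * r))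
      (a * (r ^ (a - 1) * exp (-(y * r))) - y * (r ^ (a + 1 - 1) * exp (-(y * r)))) r := by
    intro r hr
    have hr0 : r ≠ 0 := (one_pos.trans hr).ne'
    have hexp : HasDerivAt (fun r : ℝ => exp (-y * r)) (exp (-y * r) * -y) r := by
      simpa using ((hasDerivAt_id r).const_mul (-y)).exp
    refine ((hasDerivAt_rpow_const (Or.inl hr0)).mul hexp).congr_deriv ?_
    rw [add_sub_cancel_right, ← neg_mul]
    ring
  have hcont : ContinuousWithinAt (fun r : ℝ => r ^ a * exp (-y * r)) (Ici 1) 1 :=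
    ((continuousAt_rpow_const _ _ (Or.inl one_ne_zero)).mul (by fun_prop)).continuousWithinAt
  have hparts := integral_Ioi_of_hasDerivAt_of_tendsto hcont hderiv
    (((hint _).const_mul a).sub ((hint _).const_mul y))
    (tendsto_rpow_mul_exp_neg_mul_atTop_nhds_zero a y hy)
  rw [integral_sub ((hint _).const_mul a) ((hint _).const_mul y), integral_const_mul,
    integral_const_mul, one_rpow, mul_one, one_mul] at hparts
  simp only [expIntegral]
  linarith

lemma hasSum_pow_div_factorial (x : ℝ) : HasSum (fun n : ℕ => x ^ n / n.factorial) (exp x) := by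
  rw [exp_eq_exp_ℝ]
  exact NormedSpace.expSeries_div_hasSum_exp x

lemma summable_lowerGammaSeries (a y : ℝ) :
    Summable fun k : ℕ => (-y) ^ k / (k.factorial * (a + k)) := by
  refine .of_norm_bounded_eventually_nat (summable_pow_div_factorial |y|) ?_
  have hlarge : ∀ᶠ k : ℕ in atTop, 1 ≤ a + k :=
    (tendsto_atTop_add_const_left _ a tendsto_natCast_atTop_atTop).eventually_ge_atTop 1
  filter_upwards [hlarge] with k hk
  rw [norm_div, norm_pow, norm_neg, norm_mul, Real.norm_natCast, norm_eq_abs, norm_eq_abs]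
  gcongr
  exact le_mul_of_one_le_right (by positivity) (hk.trans (le_abs_self _))

lemma mul_lowerGammaSeries {a : ℝ} (ha : ∀ k : ℕ, a ≠ -k) (y : ℝ) :
    a * lowerGammaSeries a y = exp (-y) + y * lowerGammaSeries (a + 1) y := by
  have hne (k : ℕ) : a + k ≠ 0 := fun h => ha k (eq_neg_of_add_eq_zero_left h)
  have hdiff : HasSum (fun k : ℕ => (-y) ^ k / k.factorial
      - a * ((-y) ^ k / (k.factorial * (a + k)))) (exp (-y) - a * lowerGammaSeries a y) :=
    (hasSum_pow_div_factorial (-y)).sub ((summable_lowerGammaSeries a y).hasSum.mul_left a)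
  have hshift : HasSum (fun k : ℕ => -(y * ((-y) ^ k / (k.factorial * (a + 1 + k)))))
      (-(y * lowerGammaSeries (a + 1) y)) :=
    ((summable_lowerGammaSeries (a + 1) y).hasSum.mul_left y).neg
  have heq := ((hasSum_nat_add_iff' 1).2 hdiff).unique (hshift.congr_fun fun k => ?_)
  · have ha0 : a ≠ 0 := by simpa using hne 0
    simp only [Finset.sum_range_one, pow_zero, Nat.factorial_zero, Nat.cast_one, Nat.cast_zero,
      add_zero, one_mul, div_one, mul_one_div_cancel ha0] at heq
    linarith
  · have hk : a + (k + 1) ≠ 0 := mod_cast hne (k + 1)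
    have hk' : a + 1 + k ≠ 0 := by rwa [add_assoc, add_comm 1]
    rw [Nat.factorial_succ]
    push_cast
    field_simp
    ring

lemma integrableOn_rpow_sub_one_add_natCast_Ioc {a : ℝ} (ha : 0 < a) (k : ℕ) :
    IntegrableOn (fun r : ℝ => r ^ (a - 1 + k)) (Ioc 0 1) := by
  rw [← intervalIntegrable_iff_integrableOn_Ioc_of_le zero_le_one]
  exact intervalIntegral.intervalIntegrable_rpow' (by linarith [k.cast_nonneg (α := ℝ)])

lemma integral_Ioc_rpow_sub_one_add_natCast {a : ℝ} (ha : 0 < a) (k : ℕ) :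
    ∫ r in Ioc (0 : ℝ) 1, r ^ (a - 1 + k) = (a + k)⁻¹ := by
  have hexponent : -1 < a - 1 + k := by linarith [k.cast_nonneg (α := ℝ)]
  rw [← intervalIntegral.integral_of_le zero_le_one, integral_rpow (Or.inl hexponent),
    show a - 1 + k + 1 = a + k by ring, one_rpow, zero_rpow (by positivity), sub_zero, one_div]

lemma integral_Ioc_rpow_mul_exp_neg_mul {a : ℝ} (ha : 0 < a) (y : ℝ) :
    ∫ r in Ioc (0 : ℝ) 1, r ^ (a - 1) * exp (-(y * r)) = lowerGammaSeries a y := by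
  have hnorm (k : ℕ) : ∫ r in Ioc (0 : ℝ) 1, ‖(-y) ^ k / k.factorial * r ^ (a - 1 + k)‖ =
      |y| ^ k / k.factorial * (a + k)⁻¹ := by
    rw [← integral_Ioc_rpow_sub_one_add_natCast ha, ← integral_const_mul]
    refine setIntegral_congr_fun measurableSet_Ioc fun r hr => ?_
    rw [norm_mul, norm_of_nonneg (rpow_nonneg hr.1.le _), norm_div, norm_pow, norm_neg,
      Real.norm_natCast, norm_eq_abs]
  have hsummable : Summable fun k : ℕ =>
      ∫ r in Ioc (0 : ℝ) 1, ‖(-y) ^ k / k.factorial * r ^ (a - 1 + k)‖ := by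
    simp_rw [hnorm]
    refine .of_nonneg_of_le (fun k => by positivity) (fun k => ?_)
      ((summable_pow_div_factorial |y|).mul_right a⁻¹)
    gcongr
    exact le_add_of_nonneg_right k.cast_nonneg
  have hsum := hasSum_integral_of_summable_integral_norm
    (fun k => (integrableOn_rpow_sub_one_add_natCast_Ioc ha k).const_mul _) hsummable
  calc ∫ r in Ioc (0 : ℝ) 1, r ^ (a - 1) * exp (-(y * r))
      = ∫ r in Ioc (0 : ℝ) 1, ∑' k : ℕ, (-y) ^ k / k.factorial * r ^ (a - 1 + k) := by
        refine setIntegral_congr_fun measurableSet_Ioc fun r hr => ?_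
        rw [← neg_mul, ← (hasSum_pow_div_factorial (-y * r)).tsum_eq, ← tsum_mul_left]
        refine tsum_congr fun k => ?_
        rw [rpow_add hr.1, rpow_natCast, mul_pow]
        ring
    _ = lowerGammaSeries a y := by
        rw [← hsum.tsum_eq, lowerGammaSeries]
        refine tsum_congr fun k => ?_
        rw [integral_const_mul, integral_Ioc_rpow_sub_one_add_natCast ha, ← div_eq_mul_inv, div_div]

lemma expIntegral_eq_of_pos {a y : ℝ} (ha : 0 < a) (hy : 0 < y) :
    expIntegral a y = y ^ (-a) * Gamma a - lowerGammaSeries a y := by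
  have hint : IntegrableOn (fun r : ℝ => r ^ (a - 1) * exp (-(y * r))) (Ioi 0) := by
    simpa only [rpow_one, neg_mul] using
      integrableOn_rpow_mul_exp_neg_mul_rpow (s := a - 1) (by linarith) one_pos hy
  have hGamma := integral_rpow_mul_exp_neg_mul_Ioi ha hy
  rw [← Ioc_union_Ioi_eq_Ioi (zero_le_one (α := ℝ)), setIntegral_union
    (Ioc_disjoint_Ioi le_rfl) measurableSet_Ioi (hint.mono_set Ioc_subset_Ioi_self)
    (integrableOn_rpow_mul_exp_neg_mul_Ioi_one _ hy), integral_Ioc_rpow_mul_exp_neg_mul ha,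
    one_div, inv_rpow hy.le, ← rpow_neg hy.le] at hGamma
  exact eq_sub_of_add_eq' hGamma

lemma expIntegral_eq {a : ℝ} (ha : ∀ k : ℕ, a ≠ -k) {y : ℝ} (hy : 0 < y) :
    expIntegral a y = y ^ (-a) * Gamma a - lowerGammaSeries a y := by
  obtain ⟨n, hn⟩ := exists_nat_gt (-a)
  induction n generalizing a with
  | zero => exact expIntegral_eq_of_pos (by simpa using hn) hy
  | succ n ih =>
    have ha0 : a ≠ 0 := by simpa using ha 0
    have ha' (k : ℕ) : a + 1 ≠ -k := fun h => ha (k + 1) (by push_cast; linarith)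
    have hnext := ih ha' (by push_cast at hn; linarith)
    rw [Gamma_add_one ha0, neg_add, rpow_add hy, rpow_neg_one] at hnext
    apply mul_left_cancel₀ ha0
    calc a * expIntegral a y = y * expIntegral (a + 1) y - exp (-y) := by
          rw [expIntegral_add_one a hy, add_sub_cancel_left]
      _ = a * (y ^ (-a) * Gamma a) - (exp (-y) + y * lowerGammaSeries (a + 1) y) := by
          rw [hnext]
          field_simp
          ring
      _ = a * (y ^ (-a) * Gamma a - lowerGammaSeries a y) := by
          rw [← mul_lowerGammaSeries ha, mul_sub]

/-- The entire part of the modified Bessel function of the first kind,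
`I_ν(2 y) = y ^ ν * besselSeries ν y`. -/
noncomputable def besselSeries (ν y : ℝ) : ℝ :=
  ∑' m : ℕ, y ^ (2 * m) / (m.factorial * Gamma (m + ν + 1))

lemma summable_besselSeries (ν y : ℝ) :
    Summable fun m : ℕ => y ^ (2 * m) / (m.factorial * Gamma (m + ν + 1)) := by
  refine .of_norm_bounded_eventually_nat (summable_pow_div_factorial (y ^ 2)) ?_
  have hlarge : ∀ᶠ m : ℕ in atTop, 2 ≤ m + ν + 1 := by
    simp_rw [add_assoc]
    exact (tendsto_atTop_add_const_right _ (ν + 1)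
      tendsto_natCast_atTop_atTop).eventually_ge_atTop 2
  filter_upwards [hlarge] with m hm
  have hGamma : 1 ≤ Gamma (m + ν + 1) :=
    Gamma_two.ge.trans (Gamma_strictMonoOn_Ici.monotoneOn self_mem_Ici hm hm)
  rw [norm_of_nonneg (by rw [pow_mul]; positivity), pow_mul]
  gcongr
  exact le_mul_of_one_le_right (by positivity) hGamma

/-- The part over `(1, ∞)` of the integral
`∫₀^∞ r ^ (-ν - 1) exp (-y (r + 1 / r)) dr = 2 K_ν(2 y)`; the substitution `r ↦ 1 / r` turns
the part over `(0, 1)` into `besselTail (-ν) y`. -/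
noncomputable def besselTail (ν y : ℝ) : ℝ :=
  ∫ r in Ioi 1, r ^ (-ν - 1) * exp (-(y * r)) * exp (-(y / r))

lemma summable_integral_norm_besselTail (ν : ℝ) {y : ℝ} (hy : 0 < y) :
    Summable fun m : ℕ => ∫ r in Ioi (1 : ℝ),
      ‖(-y) ^ m / m.factorial * (r ^ (-ν - m - 1) * exp (-(y * r)))‖ := by
  refine .of_nonneg_of_le (fun m => integral_nonneg fun r => norm_nonneg _) (fun m => ?_)
    ((summable_pow_div_factorial y).mul_right (expIntegral (-ν) y))
  have hnorm : ∀ r ∈ Ioi (1 : ℝ),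
      ‖(-y) ^ m / m.factorial * (r ^ (-ν - m - 1) * exp (-(y * r)))‖ =
        y ^ m / m.factorial * (r ^ (-ν - m - 1) * exp (-(y * r))) := fun r hr => by
    have hr0 : 0 < r := one_pos.trans hr
    have hnonneg : 0 ≤ r ^ (-ν - m - 1) * exp (-(y * r)) := by positivity
    rw [norm_mul, norm_of_nonneg hnonneg, norm_div, norm_pow, norm_neg, norm_of_nonneg hy.le,
      Real.norm_natCast]
  rw [setIntegral_congr_fun measurableSet_Ioi hnorm, integral_const_mul]
  gcongr
  refine setIntegral_mono_on (integrableOn_rpow_mul_exp_neg_mul_Ioi_one _ hy)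
    (integrableOn_rpow_mul_exp_neg_mul_Ioi_one _ hy) measurableSet_Ioi fun r hr => ?_
  gcongr
  · exact le_of_lt hr
  · exact sub_le_self _ m.cast_nonneg

lemma hasSum_besselTail (ν : ℝ) {y : ℝ} (hy : 0 < y) :
    HasSum (fun m : ℕ => (-y) ^ m / m.factorial * expIntegral (-ν - m) y) (besselTail ν y) := by
  have hint (m : ℕ) := integrableOn_rpow_mul_exp_neg_mul_Ioi_one (-ν - m - 1) hy
  have hsum := hasSum_integral_of_summable_integral_norm
    (fun m => Integrable.const_mul (hint m) ((-y) ^ m / m.factorial))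
    (summable_integral_norm_besselTail ν hy)
  simp_rw [integral_const_mul] at hsum
  refine (?_ : besselTail ν y = _) ▸ hsum
  refine setIntegral_congr_fun measurableSet_Ioi fun r hr => ?_
  have hr0 : 0 < r := one_pos.trans hr
  rw [← neg_div, ← (hasSum_pow_div_factorial (-y / r)).tsum_eq, ← tsum_mul_left]
  refine tsum_congr fun m => ?_
  rw [sub_right_comm, rpow_sub hr0 _ (m : ℝ), rpow_natCast, div_pow]
  ring

/-- The double series `∑_{m, k} (-y) ^ (m + k) / (m! k! (k - m - ν))` which remains when the
Gamma-function terms are taken out of `besselTail ν y`. It is odd in `ν`, and so cancels from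
`besselTail ν y + besselTail (-ν) y`. -/
noncomputable def besselRemainder (ν y : ℝ) : ℝ :=
  ∑' p : ℕ × ℕ, (-y) ^ p.1 / p.1.factorial * ((-y) ^ p.2 / (p.2.factorial * (-ν - p.1 + p.2)))

lemma besselRemainder_neg (ν y : ℝ) : besselRemainder (-ν) y = -besselRemainder ν y := by
  rw [besselRemainder, besselRemainder, ← (Equiv.prodComm ℕ ℕ).tsum_eq, ← tsum_neg]
  refine tsum_congr fun p => ?_
  simp only [Equiv.prodComm_apply, Prod.fst_swap, Prod.snd_swap]
  rw [← div_div, ← div_div, show - -ν - (p.2 : ℝ) + p.1 = -(-ν - p.1 + p.2) by ring, div_neg]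
  ring

lemma summable_besselRemainder {ν : ℝ} (hν : ∀ j : ℤ, ν ≠ j) (y : ℝ) :
    Summable fun p : ℕ × ℕ => (-y) ^ p.1 / p.1.factorial *
      ((-y) ^ p.2 / (p.2.factorial * (-ν - p.1 + p.2))) := by
  have hexp := summable_pow_div_factorial |y|
  have hround : 0 < |ν - round ν| := abs_pos.2 (sub_ne_zero.2 (hν _))
  refine .of_norm_bounded (g := fun p : ℕ × ℕ => |y| ^ p.1 / p.1.factorial *
    (|y| ^ p.2 / p.2.factorial * |ν - round ν|⁻¹)) (hexp.mul_of_nonneg (hexp.mul_right _)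
      (fun _ => by positivity) (fun _ => by positivity)) fun p => ?_
  have hfar : |ν - round ν| ≤ |-ν - p.1 + p.2| := by
    rw [← abs_neg (-ν - p.1 + p.2), show -(-ν - p.1 + p.2) = ν - ((p.2 - p.1 : ℤ) : ℝ) by
      push_cast; ring]
    exact round_le ν _
  rw [norm_mul, norm_div, norm_div, norm_mul, norm_pow, norm_pow, norm_neg, Real.norm_natCast,
    Real.norm_natCast, norm_eq_abs, norm_eq_abs, ← div_div, div_eq_mul_inv _ |_ + _|]
  gcongr

lemma neg_one_pow_mul_Gamma_neg_sub_natCast {ν : ℝ} (hν : ∀ j : ℤ, ν ≠ j) (m : ℕ) :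
    (-1) ^ m * Gamma (-ν - m) = -(π / sin (π * ν)) / Gamma (m + ν + 1) := by
  have hreflection := Gamma_mul_Gamma_one_sub (-ν - m)
  have hsin : sin (π * (-ν - m)) = -((-1) ^ m * sin (π * ν)) := by
    rw [show π * (-ν - m) = -(π * ν + m * π) by ring, sin_neg, sin_add_nat_mul_pi]
  have hGamma : Gamma (m + ν + 1) ≠ 0 := Gamma_ne_zero fun n hn => by
    refine hν (-(m + 1 + n)) ?_
    push_cast
    linarith
  rw [show (1 : ℝ) - (-ν - m) = m + ν + 1 by ring, hsin] at hreflection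
  rw [eq_div_iff hGamma, mul_assoc, hreflection]
  rcases neg_one_pow_eq_or ℝ m with h | h <;> simp [h, div_neg]

lemma besselTail_eq {ν : ℝ} (hν : ∀ j : ℤ, ν ≠ j) {y : ℝ} (hy : 0 < y) :
    besselTail ν y = -(π / sin (π * ν)) * y ^ ν * besselSeries ν y - besselRemainder ν y := by
  have hsummable := summable_besselRemainder hν y
  have hterm (m : ℕ) : (-y) ^ m / m.factorial * expIntegral (-ν - m) y +
      ∑' k : ℕ, (-y) ^ m / m.factorial * ((-y) ^ k / (k.factorial * (-ν - m + k))) =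
      -(π / sin (π * ν)) * y ^ ν * (y ^ (2 * m) / (m.factorial * Gamma (m + ν + 1))) := by
    have hm (k : ℕ) : -ν - m ≠ -k := fun h => hν (k - m) (by push_cast; linarith)
    rw [expIntegral_eq hm hy, tsum_mul_left, lowerGammaSeries, ← mul_add, sub_add_cancel,
      show -(-ν - m) = ν + (m : ℝ) by ring, rpow_add hy, rpow_natCast, neg_pow y m, ← div_div]
    linear_combination
      y ^ ν * (y ^ (2 * m) / m.factorial) * neg_one_pow_mul_Gamma_neg_sub_natCast hν m
  have hsum := (hasSum_besselTail ν hy).add hsummable.prod.hasSum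
  simp_rw [hterm] at hsum
  rw [besselSeries, ← tsum_mul_left, hsum.tsum_eq, besselRemainder, hsummable.tsum_prod,
    add_sub_cancel_right]

/-- `besselIntegral ν z = 2 z ^ (-ν / 2) K_ν(2 √z)` for `0 < z`, where `K_ν` is the modified Bessel
function of the second kind. -/
noncomputable def besselIntegral (ν z : ℝ) : ℝ :=
  ∫ s in Ioi 0, s ^ (-ν - 1) * exp (-s) * exp (-(z / s))

lemma integrableOn_besselIntegral (ν : ℝ) {z : ℝ} (hz : 0 < z) :
    IntegrableOn (fun s : ℝ => s ^ (-ν - 1) * exp (-s) * exp (-(z / s))) (Ioi 0) := by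
  obtain ⟨n, hn⟩ := exists_nat_gt ν
  have hGamma := (GammaIntegral_convergent (s := n - ν) (by linarith)).const_mul
    (n.factorial / z ^ n)
  refine hGamma.mono' (by fun_prop) ?_
  filter_upwards [ae_restrict_mem measurableSet_Ioi] with s hs
  have hs0 : (0 : ℝ) < s := hs
  have hexp : exp (-(z / s)) ≤ n.factorial / z ^ n * s ^ n := by
    rw [exp_neg, show n.factorial / z ^ n * s ^ n = ((z / s) ^ n / n.factorial)⁻¹ by
      rw [div_pow]; field_simp]
    exact inv_anti₀ (by positivity) (pow_div_factorial_le_exp _ (by positivity) n)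
  rw [norm_of_nonneg (by positivity)]
  calc s ^ (-ν - 1) * exp (-s) * exp (-(z / s))
      ≤ s ^ (-ν - 1) * exp (-s) * (n.factorial / z ^ n * s ^ n) := by gcongr
    _ = n.factorial / z ^ n * (exp (-s) * s ^ (n - ν - 1)) := by
      rw [show (n : ℝ) - ν - 1 = (-ν - 1) + n by ring, rpow_add hs0, rpow_natCast]
      ring

lemma setIntegral_Ioo_zero_one_eq_setIntegral_Ioi_one {E : Type*} [NormedAddCommGroup E]
    [NormedSpace ℝ E] (f : ℝ → E) :
    ∫ r in Ioo (0 : ℝ) 1, f r = ∫ r in Ioi (1 : ℝ), (r ^ 2)⁻¹ • f r⁻¹ := by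
  have hinv : Inv.inv '' Ioi (1 : ℝ) = Ioo 0 1 := by
    rw [image_inv_eq_inv, inv_Ioi₀ one_pos, inv_one]
  rw [← hinv, integral_image_eq_integral_abs_deriv_smul measurableSet_Ioi
    (fun r hr => (hasDerivAt_inv (one_pos.trans hr).ne').hasDerivWithinAt) inv_injective.injOn]
  simp_rw [abs_neg, abs_inv, abs_sq]

lemma setIntegral_Ioi_zero_eq_besselTail_add {ν y : ℝ}
    (hint : IntegrableOn (fun r : ℝ => r ^ (-ν - 1) * exp (-(y * r)) * exp (-(y / r))) (Ioi 0)) :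
    ∫ r in Ioi (0 : ℝ), r ^ (-ν - 1) * exp (-(y * r)) * exp (-(y / r)) =
      besselTail (-ν) y + besselTail ν y := by
  have hunit : ∫ r in Ioc (0 : ℝ) 1, r ^ (-ν - 1) * exp (-(y * r)) * exp (-(y / r)) =
      besselTail (-ν) y := by
    rw [integral_Ioc_eq_integral_Ioo, setIntegral_Ioo_zero_one_eq_setIntegral_Ioi_one]
    refine setIntegral_congr_fun measurableSet_Ioi fun r hr => ?_
    have hr0 : 0 < r := one_pos.trans hr
    have hpow : (r ^ 2)⁻¹ * r⁻¹ ^ (-ν - 1) = r ^ (- -ν - 1) := by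
      rw [inv_rpow hr0.le, ← rpow_neg hr0.le, ← rpow_two, ← rpow_neg hr0.le, ← rpow_add hr0]
      ring_nf
    rw [smul_eq_mul, div_inv_eq_mul, ← div_eq_mul_inv y r, ← hpow]
    ring
  rw [← Ioc_union_Ioi_eq_Ioi (zero_le_one (α := ℝ)), setIntegral_union (Ioc_disjoint_Ioi le_rfl)
    measurableSet_Ioi (hint.mono_set Ioc_subset_Ioi_self)
    (hint.mono_set (Ioi_subset_Ioi zero_le_one)), hunit]
  rfl

lemma besselIntegral_sq_eq_besselTail_add (ν : ℝ) {y : ℝ} (hy : 0 < y) :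
    besselIntegral ν (y ^ 2) = y ^ (-ν) * (besselTail (-ν) y + besselTail ν y) := by
  have hscale : ∀ r ∈ Ioi (0 : ℝ),
      (y * r) ^ (-ν - 1) * exp (-(y * r)) * exp (-(y ^ 2 / (y * r))) =
        y ^ (-ν - 1) * (r ^ (-ν - 1) * exp (-(y * r)) * exp (-(y / r))) := fun r hr => by
    rw [mul_rpow hy.le (le_of_lt hr), show y ^ 2 / (y * r) = y / r by field_simp]
    ring
  have hint : IntegrableOn (fun r : ℝ => r ^ (-ν - 1) * exp (-(y * r)) * exp (-(y / r)))
      (Ioi 0) := by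
    have h := integrableOn_besselIntegral ν (pow_pos hy 2)
    rw [← mul_zero y] at h
    exact (integrable_const_mul_iff (rpow_pos_of_pos hy (-ν - 1)).ne'.isUnit _).1
      (((integrableOn_Ioi_comp_mul_left_iff _ _ hy).2 h).congr_fun hscale measurableSet_Ioi)
  have hsubst := integral_comp_mul_left_Ioi
    (fun s : ℝ => s ^ (-ν - 1) * exp (-s) * exp (-(y ^ 2 / s))) 0 hy
  rw [mul_zero, setIntegral_congr_fun measurableSet_Ioi hscale, integral_const_mul,
    setIntegral_Ioi_zero_eq_besselTail_add hint, smul_eq_mul,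
    eq_inv_mul_iff_mul_eq₀ hy.ne'] at hsubst
  rw [besselIntegral, ← hsubst, rpow_sub_one hy.ne']
  field_simp

/-- In terms of modified Bessel functions,
`K_ν(2 y) = π / 2 * (I_{-ν}(2 y) - I_ν(2 y)) / sin (π ν)`. -/
lemma besselIntegral_sq {ν : ℝ} (hν : ∀ j : ℤ, ν ≠ j) {y : ℝ} (hy : 0 < y) :
    besselIntegral ν (y ^ 2) = π / sin (π * ν) *
      (y ^ (-(2 * ν)) * besselSeries (-ν) y - besselSeries ν y) := by
  have hν' (j : ℤ) : -ν ≠ j := fun h => hν (-j) (by push_cast; linarith)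
  have hcancel : y ^ (-ν) * y ^ ν = 1 := by rw [← rpow_add hy, neg_add_cancel, rpow_zero]
  have hsq : y ^ (-ν) * y ^ (-ν) = y ^ (-(2 * ν)) := by rw [← rpow_add hy]; ring_nf
  rw [besselIntegral_sq_eq_besselTail_add ν hy, besselTail_eq hν hy, besselTail_eq hν' hy,
    besselRemainder_neg, mul_neg π ν, sin_neg, div_neg, neg_neg]
  linear_combination π / sin (π * ν) * besselSeries (-ν) y * hsq -
    π / sin (π * ν) * besselSeries ν y * hcancel

lemma besselIntegral_nonneg (ν z : ℝ) : 0 ≤ besselIntegral ν z :=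
  setIntegral_nonneg measurableSet_Ioi fun s hs => by
    have hs0 : (0 : ℝ) < s := hs
    positivity

lemma besselIntegral_pos (ν : ℝ) {z : ℝ} (hz : 0 < z) : 0 < besselIntegral ν z := by
  rw [besselIntegral, setIntegral_pos_iff_support_of_nonneg_ae _ (integrableOn_besselIntegral ν hz)]
  · rw [inter_eq_self_of_subset_right fun s hs => ?_]
    · simp
    · have hs0 : (0 : ℝ) < s := hs
      exact ne_of_gt (by positivity)
  · filter_upwards [ae_restrict_mem measurableSet_Ioi] with s hs
    have hs0 : (0 : ℝ) < s := hs
    rw [Pi.zero_apply]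
    positivity

lemma continuousOn_besselIntegral (ν : ℝ) : ContinuousOn (besselIntegral ν) (Ioi 0) := by
  intro z hz
  have hz0 : (0 : ℝ) < z := hz
  refine ContinuousAt.continuousWithinAt (continuousAt_of_dominated
    (bound := fun s : ℝ => s ^ (-ν - 1) * exp (-s) * exp (-(z / 2 / s)))
    (.of_forall fun x => by fun_prop) ?_ (integrableOn_besselIntegral ν (half_pos hz0))
    (ae_of_all _ fun s => by fun_prop))
  filter_upwards [lt_mem_nhds (half_lt_self hz0)] with x hx
  filter_upwards [ae_restrict_mem measurableSet_Ioi] with s hs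
  have hs0 : (0 : ℝ) < s := hs
  rw [norm_of_nonneg (by positivity)]
  gcongr

end Bessel

section BesselKernel

open Set Real

/-- The Bessel potential kernel of order `κ` on `ℝ`: the integrable function whose Fourier transform
is `(1 + x²) ^ (-κ / 2)`. -/
noncomputable def besselKernel (κ l : ℝ) : ℝ :=
  (Gamma (κ / 2) * √(4 * π))⁻¹ * besselIntegral ((1 - κ) / 2) ((l / 2) ^ 2)

lemma besselKernel_nonneg {κ : ℝ} (hκ : 0 < κ) (l : ℝ) : 0 ≤ besselKernel κ l := by
  have := Gamma_pos_of_pos (half_pos hκ)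
  exact mul_nonneg (by positivity) (besselIntegral_nonneg _ _)

lemma besselKernel_pos {κ : ℝ} (hκ : 0 < κ) {l : ℝ} (hl : l ≠ 0) : 0 < besselKernel κ l := by
  have := Gamma_pos_of_pos (half_pos hκ)
  exact mul_pos (by positivity) (besselIntegral_pos _ (by positivity))

lemma continuousAt_besselKernel (κ : ℝ) {l : ℝ} (hl : l ≠ 0) :
    ContinuousAt (besselKernel κ) l := by
  have hsq : 0 < (l / 2) ^ 2 := by positivity
  have hcont := (continuousOn_besselIntegral ((1 - κ) / 2)).continuousAt (Ioi_mem_nhds hsq)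
  exact continuousAt_const.mul (hcont.comp (f := fun l : ℝ => (l / 2) ^ 2) (by fun_prop))

lemma theta_eq {κ u : ℝ} (hu : 0 < u) :
    theta κ u = Gamma ((κ + 1) / 2) * ((u / 2) ^ (1 - κ) * besselSeries ((1 - κ) / 2) (u / 2)
      - (besselSeries (-((1 - κ) / 2)) (u / 2) - (Gamma ((κ + 1) / 2))⁻¹)) := by
  have hu2 : 0 < u / 2 := half_pos hu
  have hfirst (k : ℕ) : (u / 2) ^ (2 * ((k : ℝ) + 1) + 1 - κ) /
      ((k + 1).factorial * Gamma ((k : ℝ) + 1 - (κ - 1) / 2 + 1)) = (u / 2) ^ (1 - κ) *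
      ((u / 2) ^ (2 * (k + 1)) / ((k + 1).factorial *
        Gamma (((k + 1 : ℕ) : ℝ) + (1 - κ) / 2 + 1))) := by
    rw [show 2 * ((k : ℝ) + 1) + 1 - κ = (1 - κ) + ((2 * (k + 1) : ℕ) : ℝ) by push_cast; ring,
      rpow_add hu2, rpow_natCast,
      show (k : ℝ) + 1 - (κ - 1) / 2 + 1 = ((k + 1 : ℕ) : ℝ) + (1 - κ) / 2 + 1 by push_cast; ring]
    ring
  have hsecond (k : ℕ) :
      (k : ℝ) + 1 + (κ - 1) / 2 + 1 = ((k + 1 : ℕ) : ℝ) + -((1 - κ) / 2) + 1 := by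
    push_cast
    ring
  rw [besselSeries, besselSeries, (summable_besselSeries _ _).tsum_eq_zero_add,
    (summable_besselSeries _ _).tsum_eq_zero_add, theta]
  simp_rw [hfirst, hsecond, tsum_mul_left]
  simp only [mul_zero, pow_zero, Nat.factorial_zero, Nat.cast_one, one_mul, Nat.cast_zero, zero_add]
  rw [show (3 - κ) / 2 = (1 - κ) / 2 + 1 by ring, show -((1 - κ) / 2) + 1 = (κ + 1) / 2 by ring]
  ring

lemma one_sub_theta {κ u : ℝ} (hκ : 0 < κ) (hu : 0 < u) :
    1 - theta κ u = Gamma ((κ + 1) / 2) * (besselSeries (-((1 - κ) / 2)) (u / 2) -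
      (u / 2) ^ (1 - κ) * besselSeries ((1 - κ) / 2) (u / 2)) := by
  have hGamma : Gamma ((κ + 1) / 2) ≠ 0 := (Gamma_pos_of_pos (by linarith)).ne'
  rw [theta_eq hu]
  field_simp
  ring

lemma one_sub_div_two_ne_intCast {κ : ℝ} (hκ : 0 < κ) (hodd : ∀ n : ℕ, κ ≠ 2 * n + 1) (j : ℤ) :
    (1 - κ) / 2 ≠ j := by
  intro h
  obtain ⟨n, hn⟩ : ∃ n : ℕ, -j = n := Int.eq_ofNat_of_zero_le <| by
    have hj : (j : ℝ) < 1 := by linarith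
    have hj' : j < 1 := mod_cast hj
    linarith
  have hn' : -(j : ℝ) = n := mod_cast hn
  exact hodd n (by linarith)

lemma besselIntegral_half_sq {κ u : ℝ} (hκ : 0 < κ) (hodd : ∀ n : ℕ, κ ≠ 2 * n + 1) (hu : 0 < u) :
    besselIntegral ((1 - κ) / 2) ((u / 2) ^ 2) =
      π / (Gamma ((κ + 1) / 2) * cos (κ * π / 2)) * ((1 - theta κ u) / (u / 2) ^ (1 - κ)) := by
  have hGamma : Gamma ((κ + 1) / 2) ≠ 0 := (Gamma_pos_of_pos (by linarith)).ne'
  have hsin : sin (π * ((1 - κ) / 2)) = cos (κ * π / 2) := by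
    rw [← sin_pi_div_two_sub]
    ring_nf
  have hpow : (u / 2) ^ (-(2 * ((1 - κ) / 2))) = ((u / 2) ^ (1 - κ))⁻¹ := by
    rw [← rpow_neg (half_pos hu).le]
    ring_nf
  rw [besselIntegral_sq (one_sub_div_two_ne_intCast hκ hodd) (half_pos hu), hsin, hpow,
    one_sub_theta hκ hu]
  field_simp

lemma besselKernel_eq {κ l : ℝ} (hκ : 0 < κ) (hodd : ∀ n : ℕ, κ ≠ 2 * n + 1) (hl : l ≠ 0) :
    besselKernel κ l = cTwo κ * ((1 - theta κ |l|) / |l| ^ (1 - κ)) := by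
  have := Gamma_pos_of_pos hκ
  have := Gamma_pos_of_pos (half_pos hκ)
  have := Gamma_pos_of_pos (show 0 < (κ + 1) / 2 by linarith)
  have hduplication : Gamma (κ / 2) * Gamma ((κ + 1) / 2) = Gamma κ * 2 ^ (1 - κ) * √π := by
    have h := Gamma_mul_Gamma_add_half (κ / 2)
    rwa [← add_div, mul_div_cancel₀ _ two_ne_zero] at h
  have hconst : (Gamma (κ / 2) * √(4 * π))⁻¹ *
      (π / (Gamma ((κ + 1) / 2) * cos (κ * π / 2))) * 2 ^ (1 - κ) = cTwo κ := by
    have hsqrt : √(4 * π) = 2 * √π := by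
      rw [sqrt_mul zero_le_four, show (4 : ℝ) = 2 ^ 2 by norm_num, sqrt_sq zero_le_two]
    calc (Gamma (κ / 2) * √(4 * π))⁻¹ *
        (π / (Gamma ((κ + 1) / 2) * cos (κ * π / 2))) * 2 ^ (1 - κ)
        = π * 2 ^ (1 - κ) / (2 * √π * cos (κ * π / 2) *
            (Gamma (κ / 2) * Gamma ((κ + 1) / 2))) := by
          rw [hsqrt]
          field_simp
      _ = cTwo κ := by
          rw [hduplication, cTwo]
          nth_rewrite 1 [← sq_sqrt pi_pos.le]
          field_simp
  rw [besselKernel, ← sq_abs, abs_div, abs_two, besselIntegral_half_sq hκ hodd (abs_pos.2 hl),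
    div_rpow (abs_nonneg l) zero_le_two, ← hconst]
  field_simp

lemma integrable_exp_neg_half_sq_div {s : ℝ} (hs : 0 < s) :
    Integrable fun l : ℝ => exp (-((l / 2) ^ 2 / s)) := by
  refine (integrable_exp_neg_mul_sq (b := (4 * s)⁻¹) (by positivity)).congr
    (ae_of_all _ fun l => ?_)
  dsimp only
  congr 1
  field_simp
  ring

lemma integral_exp_neg_half_sq_div_mul_exp {s : ℝ} (hs : 0 < s) (x : ℝ) :
    ∫ l : ℝ, (exp (-((l / 2) ^ 2 / s)) : ℂ) * Complex.exp (Complex.I * x * l) =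
      (√(4 * π * s) * exp (-(x ^ 2 * s)) : ℝ) := by
  have hs0 : (s : ℂ) ≠ 0 := mod_cast hs.ne'
  have hfourier := fourierIntegral_gaussian (b := ((4 * s)⁻¹ : ℝ))
    (by rw [Complex.ofReal_re]; positivity) x
  have hsqrt : ((π : ℂ) / ((4 * s)⁻¹ : ℝ)) ^ (1 / 2 : ℂ) = (√(4 * π * s) : ℝ) := by
    rw [← Complex.ofReal_div, div_inv_eq_mul, sqrt_eq_rpow, Complex.ofReal_cpow (by positivity)]
    push_cast
    ring_nf
  calc ∫ l : ℝ, (exp (-((l / 2) ^ 2 / s)) : ℂ) * Complex.exp (Complex.I * x * l)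
      = ∫ l : ℝ, Complex.exp (Complex.I * x * l) * Complex.exp (-((4 * s)⁻¹ : ℝ) * l ^ 2) := by
        congr with l
        rw [mul_comm]
        push_cast
        congr 2
        field_simp
        ring
    _ = (√(4 * π * s) * exp (-(x ^ 2 * s)) : ℝ) := by
        rw [hfourier, hsqrt]
        push_cast
        congr 2
        field_simp

lemma integral_exp_neg_half_sq_div {s : ℝ} (hs : 0 < s) :
    ∫ l : ℝ, exp (-((l / 2) ^ 2 / s)) = √(4 * π * s) := by
  have h := integral_exp_neg_half_sq_div_mul_exp hs 0
  simp only [Complex.ofReal_zero, mul_zero, zero_mul, Complex.exp_zero, mul_one, ne_eq,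
    OfNat.ofNat_ne_zero, not_false_eq_true, zero_pow, neg_zero, exp_zero] at h
  rw [integral_complex_ofReal] at h
  exact_mod_cast h

lemma rpow_mul_sqrt_four_pi_mul (ν : ℝ) {s : ℝ} (hs : 0 < s) :
    s ^ (-ν - 1) * √(4 * π * s) = √(4 * π) * s ^ (1 / 2 - ν - 1) := by
  rw [sqrt_mul (by positivity), sqrt_eq_rpow s, show (1 : ℝ) / 2 - ν - 1 = -ν - 1 + 1 / 2 by ring,
    rpow_add hs]
  ring

lemma integrable_prod_besselIntegral {ν : ℝ} (hν : ν < 1 / 2) :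
    Integrable (fun p : ℝ × ℝ => p.2 ^ (-ν - 1) * exp (-p.2) * exp (-((p.1 / 2) ^ 2 / p.2)))
      (volume.prod (volume.restrict (Ioi 0))) := by
  have hmeas : Measurable fun p : ℝ × ℝ =>
      p.2 ^ (-ν - 1) * exp (-p.2) * exp (-((p.1 / 2) ^ 2 / p.2)) := by fun_prop
  refine (integrable_prod_iff' hmeas.aestronglyMeasurable).2 ⟨?_, ?_⟩
  · filter_upwards [ae_restrict_mem measurableSet_Ioi] with s hs
    exact (integrable_exp_neg_half_sq_div hs).const_mul _
  · refine IntegrableOn.congr_fun ((GammaIntegral_convergent (s := 1 / 2 - ν)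
      (by linarith)).const_mul √(4 * π)) (fun s hs => ?_) measurableSet_Ioi
    have hs0 : (0 : ℝ) < s := hs
    have hnorm (l : ℝ) : ‖s ^ (-ν - 1) * exp (-s) * exp (-((l / 2) ^ 2 / s))‖ =
        s ^ (-ν - 1) * exp (-s) * exp (-((l / 2) ^ 2 / s)) := norm_of_nonneg (by positivity)
    simp only [hnorm]
    rw [integral_const_mul, integral_exp_neg_half_sq_div hs0]
    linear_combination -exp (-s) * rpow_mul_sqrt_four_pi_mul ν hs0

lemma norm_exp_I_mul_mul (x l : ℝ) : ‖Complex.exp (Complex.I * x * l)‖ = 1 := by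
  rw [mul_assoc, ← Complex.ofReal_mul, Complex.norm_exp_I_mul_ofReal]

lemma integrable_ofReal_mul_exp {f : ℝ → ℝ} (hf : Integrable f) (x : ℝ) :
    Integrable fun l => (f l : ℂ) * Complex.exp (Complex.I * x * l) :=
  hf.ofReal.mul_bdd (c := 1) (Continuous.aestronglyMeasurable (by fun_prop))
    (ae_of_all _ fun l => (norm_exp_I_mul_mul x l).le)

lemma integral_besselIntegral_mul_exp {ν : ℝ} (hν : ν < 1 / 2) (x : ℝ) :
    ∫ l : ℝ, (besselIntegral ν ((l / 2) ^ 2) : ℂ) * Complex.exp (Complex.I * x * l) =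
      (√(4 * π) * ((1 + x ^ 2) ^ (-(1 / 2 - ν)) * Gamma (1 / 2 - ν)) : ℝ) := by
  have hx : 0 < 1 + x ^ 2 := by positivity
  have hint : Integrable (Function.uncurry fun l s : ℝ =>
      ((s ^ (-ν - 1) * exp (-s) * exp (-((l / 2) ^ 2 / s)) : ℝ) : ℂ) *
        Complex.exp (Complex.I * x * l)) (volume.prod (volume.restrict (Ioi 0))) :=
    (integrable_prod_besselIntegral hν).ofReal.mul_bdd (c := 1)
      (Continuous.aestronglyMeasurable (by fun_prop))
      (ae_of_all _ fun p => (norm_exp_I_mul_mul x p.1).le)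
  have hinner : ∀ s ∈ Ioi (0 : ℝ),
      ∫ l : ℝ, ((s ^ (-ν - 1) * exp (-s) * exp (-((l / 2) ^ 2 / s)) : ℝ) : ℂ) *
        Complex.exp (Complex.I * x * l) =
      (√(4 * π) * (s ^ (1 / 2 - ν - 1) * exp (-((1 + x ^ 2) * s))) : ℝ) := by
    intro s hs
    simp_rw [Complex.ofReal_mul (_ * _), mul_assoc]
    rw [integral_const_mul]
    simp_rw [← mul_assoc]
    rw [integral_exp_neg_half_sq_div_mul_exp hs, ← Complex.ofReal_mul, one_add_mul, neg_add,
      exp_add]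
    congr 1
    linear_combination exp (-s) * exp (-(x ^ 2 * s)) * rpow_mul_sqrt_four_pi_mul ν hs
  have hswap := integral_integral_swap hint
  rw [setIntegral_congr_fun measurableSet_Ioi hinner, integral_complex_ofReal, integral_const_mul,
    integral_rpow_mul_exp_neg_mul_Ioi (by linarith) hx, one_div, inv_rpow hx.le,
    ← rpow_neg hx.le] at hswap
  simp_rw [integral_mul_const, integral_complex_ofReal] at hswap
  exact hswap

lemma integrable_besselKernel {κ : ℝ} (hκ : 0 < κ) : Integrable (besselKernel κ) :=
  (integrable_prod_besselIntegral (ν := (1 - κ) / 2) (by linarith)).integral_prod_left.const_mul _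

lemma integral_besselKernel_mul_exp {κ : ℝ} (hκ : 0 < κ) (x : ℝ) :
    ∫ l : ℝ, (besselKernel κ l : ℂ) * Complex.exp (Complex.I * x * l) =
      ((1 + x ^ 2) ^ (-(κ / 2)) : ℝ) := by
  have := Gamma_pos_of_pos (half_pos hκ)
  simp_rw [besselKernel, Complex.ofReal_mul _ (besselIntegral _ _), mul_assoc (Complex.ofReal _)]
  rw [integral_const_mul, integral_besselIntegral_mul_exp (by linarith), ← Complex.ofReal_mul,
    show 1 / 2 - (1 - κ) / 2 = κ / 2 by ring]
  congr 1
  field_simp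

end BesselKernel

section SpecDensity

open Set Real

lemma specDensity_zero (κ w : ℝ) :
    specDensity κ w 0 = cTwo κ / |w| ^ (1 - κ) * (1 - theta κ |w|) := by
  rw [specDensity, zero_add, zero_sub, abs_neg]
  ring

lemma specDensity_neg (κ w l : ℝ) : specDensity κ w (-l) = specDensity κ w l := by
  rw [specDensity, specDensity, ← abs_neg (l + w), ← abs_neg (l - w), neg_add', neg_sub',
    sub_neg_eq_add, add_comm (_ / _)]

variable {κ : ℝ}

lemma specDensity_eq (hκ : 0 < κ) (hodd : ∀ n : ℕ, κ ≠ 2 * n + 1) {w l : ℝ} (hadd : l + w ≠ 0)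
    (hsub : l - w ≠ 0) :
    specDensity κ w l = (besselKernel κ (l + w) + besselKernel κ (l - w)) / 2 := by
  rw [besselKernel_eq hκ hodd hadd, besselKernel_eq hκ hodd hsub, specDensity]
  ring

lemma specDensity_ae_eq (hκ : 0 < κ) (hodd : ∀ n : ℕ, κ ≠ 2 * n + 1) (w : ℝ) :
    specDensity κ w =ᵐ[volume] fun l => (besselKernel κ (l + w) + besselKernel κ (l - w)) / 2 := by
  have hneg : ∀ᵐ l : ℝ, l ≠ -w := compl_mem_ae_iff.2 (measure_singleton (-w))
  have hpos : ∀ᵐ l : ℝ, l ≠ w := compl_mem_ae_iff.2 (measure_singleton w)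
  filter_upwards [hneg, hpos] with l hl hl'
  exact specDensity_eq hκ hodd (mt eq_neg_of_add_eq_zero_left hl) (sub_ne_zero.2 hl')

lemma specDensity_nonneg_ae (hκ : 0 < κ) (hodd : ∀ n : ℕ, κ ≠ 2 * n + 1) (w : ℝ) :
    0 ≤ᵐ[volume] specDensity κ w := by
  filter_upwards [specDensity_ae_eq hκ hodd w] with l hl
  rw [hl]
  exact div_nonneg (add_nonneg (besselKernel_nonneg hκ _) (besselKernel_nonneg hκ _)) zero_le_two

lemma integrable_specDensity (hκ : 0 < κ) (hodd : ∀ n : ℕ, κ ≠ 2 * n + 1) (w : ℝ) :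
    Integrable (specDensity κ w) :=
  ((((integrable_besselKernel hκ).comp_add_right w).add
    ((integrable_besselKernel hκ).comp_sub_right w)).div_const 2).congr
    (specDensity_ae_eq hκ hodd w).symm

lemma specDensity_zero_pos (hκ : 0 < κ) (hodd : ∀ n : ℕ, κ ≠ 2 * n + 1) {w : ℝ} (hw : w ≠ 0) :
    0 < specDensity κ w 0 := by
  rw [specDensity_eq hκ hodd (by simpa using hw) (by simpa using hw)]
  exact half_pos (add_pos (besselKernel_pos hκ (by simpa using hw))
    (besselKernel_pos hκ (by simpa using hw)))

lemma continuousAt_specDensity_zero (hκ : 0 < κ) (hodd : ∀ n : ℕ, κ ≠ 2 * n + 1) {w : ℝ}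
    (hw : w ≠ 0) : ContinuousAt (specDensity κ w) 0 := by
  have hadd : Tendsto (fun l => l + w) (𝓝 0) (𝓝 w) :=
    (continuous_add_const w).tendsto' _ _ (zero_add w)
  have hsub : Tendsto (fun l => l - w) (𝓝 0) (𝓝 (-w)) :=
    (continuous_sub_right w).tendsto' _ _ (zero_sub w)
  have hkernel : ContinuousAt
      (fun l => (besselKernel κ (l + w) + besselKernel κ (l - w)) / 2) 0 := by
    refine ContinuousAt.div_const (ContinuousAt.add ?_ ?_) 2
    · exact (continuousAt_besselKernel κ (l := 0 + w) (by simpa using hw)).comp (f := (· + w))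
        (by fun_prop)
    · exact (continuousAt_besselKernel κ (l := 0 - w) (by simpa using hw)).comp (f := (· - w))
        (by fun_prop)
  refine hkernel.congr ?_
  filter_upwards [hadd.eventually_ne hw, hsub.eventually_ne (neg_ne_zero.2 hw)] with l hl hl'
  exact (specDensity_eq hκ hodd hl hl').symm

lemma integral_comp_add_right_mul_exp (f : ℝ → ℂ) (w x : ℝ) :
    ∫ l : ℝ, f (l + w) * Complex.exp (Complex.I * x * l) =
      Complex.exp (-(w * x) * Complex.I) * ∫ l : ℝ, f l * Complex.exp (Complex.I * x * l) := by
  rw [← integral_add_right_eq_self (fun l : ℝ => f l * Complex.exp (Complex.I * x * l)) w,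
    ← integral_const_mul]
  refine integral_congr_ae (ae_of_all _ fun l => ?_)
  dsimp only
  rw [mul_left_comm, ← Complex.exp_add]
  push_cast
  ring_nf

lemma integral_specDensity_mul_exp (hκ : 0 < κ) (hodd : ∀ n : ℕ, κ ≠ 2 * n + 1) (w x : ℝ) :
    ∫ l : ℝ, (specDensity κ w l : ℂ) * Complex.exp (Complex.I * x * l) =
      (cos (w * x) / (1 + x ^ 2) ^ (κ / 2) : ℝ) := by
  have hint (v : ℝ) : Integrable fun l => (besselKernel κ (l + v) : ℂ) *
      Complex.exp (Complex.I * x * l) :=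
    integrable_ofReal_mul_exp ((integrable_besselKernel hκ).comp_add_right v) x
  have hshift (v : ℝ) : ∫ l : ℝ, (besselKernel κ (l + v) : ℂ) * Complex.exp (Complex.I * x * l) =
      Complex.exp (-(v * x) * Complex.I) * ((1 + x ^ 2) ^ (-(κ / 2)) : ℝ) := by
    rw [← integral_besselKernel_mul_exp hκ,
      integral_comp_add_right_mul_exp (fun l => besselKernel κ l)]
  calc ∫ l : ℝ, (specDensity κ w l : ℂ) * Complex.exp (Complex.I * x * l)
      = ∫ l : ℝ, ((besselKernel κ (l + w) : ℂ) * Complex.exp (Complex.I * x * l) +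
          (besselKernel κ (l + -w) : ℂ) * Complex.exp (Complex.I * x * l)) / 2 := by
        refine integral_congr_ae ?_
        filter_upwards [specDensity_ae_eq hκ hodd w] with l hl
        rw [hl, sub_eq_add_neg]
        push_cast
        ring
    _ = (cos (w * x) / (1 + x ^ 2) ^ (κ / 2) : ℝ) := by
        rw [integral_div, integral_add (hint w) (hint (-w)), hshift, hshift,
          rpow_neg (by positivity), Complex.ofReal_div, Complex.ofReal_cos, Complex.cos]
        push_cast
        ring_nf

end SpecDensity

section HeatKernel

lemma heatKernelFourier_neg (μ t x l : ℝ) :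
    heatKernelFourier μ t x (-l) = (starRingEnd ℂ) (heatKernelFourier μ t x l) := by
  rw [heatKernelFourier, heatKernelFourier, ← Complex.exp_conj]
  congr 1
  simp

lemma norm_heatKernelFourier (μ t x l : ℝ) :
    ‖heatKernelFourier μ t x l‖ = Real.exp (-(μ * t * l ^ 2)) := by
  rw [heatKernelFourier, Complex.norm_exp]
  congr 1
  simp [← Complex.ofReal_pow]

lemma continuous_heatKernelFourier (μ t x : ℝ) : Continuous (heatKernelFourier μ t x) := by
  unfold heatKernelFourier
  fun_prop

lemma norm_heatKernelFourier_le_one {μ t : ℝ} (hμt : 0 ≤ μ * t) (x l : ℝ) :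
    ‖heatKernelFourier μ t x l‖ ≤ 1 := by
  rw [norm_heatKernelFourier, Real.exp_le_one_iff, neg_nonpos]
  positivity

lemma norm_heatKernelFourier_sq (μ t x l : ℝ) :
    ‖heatKernelFourier μ t x l‖ ^ 2 = Real.exp (-(2 * (μ * t)) * l ^ 2) := by
  rw [norm_heatKernelFourier, ← Real.exp_nat_mul]
  congr 1
  push_cast
  ring

lemma memLp_heatKernelFourier {μ t : ℝ} (hμt : 0 < μ * t) (x : ℝ) :
    MemLp (heatKernelFourier μ t x) 2 volume := by
  rw [memLp_two_iff_integrable_sq_norm (continuous_heatKernelFourier μ t x).aestronglyMeasurable]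
  simp_rw [norm_heatKernelFourier_sq]
  exact integrable_exp_neg_mul_sq (by positivity)

/-- The integrand `l ↦ exp(i l x - μ t l²) √(f(l √ε))` of the rescaled solution for an initial
condition with spectral density `f`. At `ε = 0` it is the integrand of the limit field. -/
noncomputable def scaledHeatKernel (f : ℝ → ℝ) (μ ε t x l : ℝ) : ℂ :=
  heatKernelFourier μ t x l * (√(f (l * √ε)) : ℝ)

lemma scaledHeatKernel_zero (f : ℝ → ℝ) (μ t x : ℝ) :
    scaledHeatKernel f μ 0 t x = fun l => heatKernelFourier μ t x l * (√(f 0) : ℝ) := by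
  funext l
  rw [scaledHeatKernel, Real.sqrt_zero, mul_zero]

lemma scaledHeatKernel_neg {f : ℝ → ℝ} (hf : ∀ l, f (-l) = f l) (μ ε t x l : ℝ) :
    scaledHeatKernel f μ ε t x (-l) = (starRingEnd ℂ) (scaledHeatKernel f μ ε t x l) := by
  rw [scaledHeatKernel, scaledHeatKernel, heatKernelFourier_neg, neg_mul, hf, map_mul,
    Complex.conj_ofReal]

lemma sq_sqrt_sub_sqrt_le_abs_sub (a b : ℝ) : (√a - √b) ^ 2 ≤ |a - b| := by
  wlog hab : b ≤ a generalizing a b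
  · rw [← neg_sub, neg_sq, abs_sub_comm]
    exact this b a (le_of_not_ge hab)
  rcases le_total a 0 with ha | ha
  · rw [Real.sqrt_eq_zero'.2 ha, Real.sqrt_eq_zero'.2 (hab.trans ha), sub_zero,
      zero_pow two_ne_zero]
    exact abs_nonneg _
  have hsqrt : √b ≤ √a := Real.sqrt_le_sqrt hab
  have hb : b ≤ √b ^ 2 := by
    rcases le_total b 0 with hb | hb
    · exact hb.trans (sq_nonneg _)
    · rw [Real.sq_sqrt hb]
  calc (√a - √b) ^ 2 ≤ √a ^ 2 - √b ^ 2 := by nlinarith [Real.sqrt_nonneg b]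
    _ ≤ |a - b| := by
      rw [Real.sq_sqrt ha, abs_of_nonneg (sub_nonneg.2 hab)]
      exact sub_le_sub_left hb a

lemma memLp_scaledHeatKernel {f : ℝ → ℝ} (hf : Integrable f) {μ t ε : ℝ} (hμt : 0 < μ * t)
    (hε : 0 ≤ ε) (x : ℝ) : MemLp (scaledHeatKernel f μ ε t x) 2 volume := by
  rcases hε.eq_or_lt with rfl | hε
  · rw [scaledHeatKernel_zero]
    exact (memLp_heatKernelFourier hμt x).mul_const _
  have hscaled : Integrable fun l => f (l * √ε) := hf.comp_mul_right' (Real.sqrt_pos.2 hε).ne'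
  have hmeas : AEStronglyMeasurable (scaledHeatKernel f μ ε t x) volume :=
    (continuous_heatKernelFourier μ t x).aestronglyMeasurable.mul
      ((Complex.continuous_ofReal.comp Real.continuous_sqrt).comp_aestronglyMeasurable
        hscaled.aestronglyMeasurable)
  rw [memLp_two_iff_integrable_sq_norm hmeas]
  refine hscaled.norm.mono' (hmeas.norm.pow 2) (ae_of_all _ fun l => ?_)
  rw [Real.norm_of_nonneg (by positivity), scaledHeatKernel, norm_mul, mul_pow, Complex.norm_real]
  calc ‖heatKernelFourier μ t x l‖ ^ 2 * ‖√(f (l * √ε))‖ ^ 2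
      ≤ 1 * ‖√(f (l * √ε))‖ ^ 2 := by
        gcongr
        exact pow_le_one₀ (norm_nonneg _) (norm_heatKernelFourier_le_one hμt.le x l)
    _ ≤ ‖f (l * √ε)‖ := by
        simpa using sq_sqrt_sub_sqrt_le_abs_sub (f (l * √ε)) 0

lemma tendsto_integral_mul_exp_neg_mul_sq {g : ℝ → ℝ} (hg : Integrable g)
    (hg0 : ContinuousAt g 0) {b : ℝ} (hb : 0 < b) :
    Tendsto (fun c : ℝ => ∫ l, c * Real.exp (-b * (c * l) ^ 2) * g l) atTop
      (𝓝 (√(Real.pi / b) * g 0)) := by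
  have hdecay : Tendsto (fun l : ℝ => ‖l‖ ^ Module.finrank ℝ ℝ *
      ((√(Real.pi / b))⁻¹ * Real.exp (-b * l ^ 2))) (Bornology.cobounded ℝ) (𝓝 0) := by
    rw [Metric.cobounded_eq_cocompact]
    have hlim := (tendsto_rpow_abs_mul_exp_neg_mul_sq_cocompact hb 1).const_mul (√(Real.pi / b))⁻¹
    rw [mul_zero] at hlim
    refine hlim.congr fun l => ?_
    rw [Module.finrank_self, pow_one, Real.rpow_one, Real.norm_eq_abs, mul_left_comm]
  have hmass : ∫ l : ℝ, (√(Real.pi / b))⁻¹ * Real.exp (-b * l ^ 2) = 1 := by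
    rw [integral_const_mul, integral_gaussian, inv_mul_cancel₀ (by positivity)]
  refine ((tendsto_integral_comp_smul_smul_of_integrable (fun l => by positivity) hmass hdecay hg
    hg0).const_mul √(Real.pi / b)).congr fun c => ?_
  rw [← integral_const_mul]
  congr with l
  rw [Module.finrank_self, pow_one, smul_eq_mul, smul_eq_mul]
  field_simp

lemma integrable_exp_neg_mul_sq_mul_abs_sub {f : ℝ → ℝ} (hf : Integrable f) {b : ℝ} (hb : 0 < b)
    (a : ℝ) : Integrable fun l => Real.exp (-b * l ^ 2) * |f l - a| := by
  have hsub : Integrable fun l => Real.exp (-b * l ^ 2) * (f l - a) := by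
    simp_rw [mul_sub]
    refine (hf.bdd_mul (c := 1) (Continuous.aestronglyMeasurable (by fun_prop))
      (ae_of_all _ fun l => ?_)).sub ((integrable_exp_neg_mul_sq hb).mul_const a)
    rw [Real.norm_of_nonneg (Real.exp_nonneg _), Real.exp_le_one_iff]
    nlinarith [sq_nonneg l]
  refine hsub.norm.congr (ae_of_all _ fun l => ?_)
  dsimp only
  rw [norm_mul, Real.norm_of_nonneg (Real.exp_nonneg _), Real.norm_eq_abs]

lemma integral_exp_mul_abs_sub_le {f : ℝ → ℝ} (hf : Integrable f) (a : ℝ) {b : ℝ} (hb : 0 < b)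
    {c : ℝ} (hc : 1 ≤ c) :
    ∫ l, Real.exp (-(2 * b) * l ^ 2) * |f (l * c⁻¹) - a| ≤
      ∫ l, c * Real.exp (-b * (c * l) ^ 2) * (Real.exp (-b * l ^ 2) * |f l - a|) := by
  have hc0 : 0 < c := one_pos.trans_le hc
  have hsubst := Measure.integral_comp_mul_right
    (fun l => Real.exp (-(2 * b) * (c * l) ^ 2) * |f l - a|) c⁻¹
  have hcancel (l : ℝ) : c * (l * c⁻¹) = l := by field_simp
  simp only [hcancel] at hsubst
  rw [hsubst, inv_inv, abs_of_pos hc0, smul_eq_mul, ← integral_const_mul]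
  refine integral_mono_of_nonneg (ae_of_all _ fun l => by positivity) ?_ (ae_of_all _ fun l => ?_)
  · refine (integrable_exp_neg_mul_sq_mul_abs_sub hf hb a).bdd_mul (c := c)
      (Continuous.aestronglyMeasurable (by fun_prop)) (ae_of_all _ fun l => ?_)
    rw [Real.norm_of_nonneg (by positivity)]
    refine mul_le_of_le_one_right hc0.le (Real.exp_le_one_iff.2 ?_)
    nlinarith [sq_nonneg (c * l)]
  · have hexp : Real.exp (-(2 * b) * (c * l) ^ 2) ≤
        Real.exp (-b * (c * l) ^ 2) * Real.exp (-b * l ^ 2) := by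
      rw [← Real.exp_add, Real.exp_le_exp]
      have hsq : l ^ 2 ≤ (c * l) ^ 2 := by
        rw [mul_pow]
        exact le_mul_of_one_le_left (sq_nonneg l) (one_le_pow₀ hc)
      nlinarith
    calc c * (Real.exp (-(2 * b) * (c * l) ^ 2) * |f l - a|)
        ≤ c * (Real.exp (-b * (c * l) ^ 2) * Real.exp (-b * l ^ 2) * |f l - a|) := by gcongr
      _ = _ := by ring

lemma tendsto_integral_exp_mul_abs_sub {f : ℝ → ℝ} (hf : Integrable f) (hf0 : ContinuousAt f 0)
    {b : ℝ} (hb : 0 < b) :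
    Tendsto (fun ε : ℝ => ∫ l, Real.exp (-(2 * b) * l ^ 2) * |f (l * √ε) - f 0|)
      (𝓝[>] 0) (𝓝 0) := by
  have hsqrt : Tendsto (fun ε : ℝ => √ε) (𝓝[>] 0) (𝓝[>] 0) := by
    refine tendsto_nhdsWithin_iff.2 ⟨?_, ?_⟩
    · exact (Real.continuous_sqrt.tendsto' 0 0 Real.sqrt_zero).mono_left nhdsWithin_le_nhds
    · filter_upwards [self_mem_nhdsWithin] with ε hε using Real.sqrt_pos.2 hε
  have hscale : Tendsto (fun ε : ℝ => (√ε)⁻¹) (𝓝[>] 0) atTop :=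
    tendsto_inv_nhdsGT_zero.comp hsqrt
  have hlim := (tendsto_integral_mul_exp_neg_mul_sq
    (integrable_exp_neg_mul_sq_mul_abs_sub hf hb (f 0))
    (ContinuousAt.mul (by fun_prop) (hf0.sub continuousAt_const).abs) hb).comp hscale
  rw [sub_self, abs_zero, mul_zero, mul_zero] at hlim
  refine tendsto_of_tendsto_of_tendsto_of_le_of_le' tendsto_const_nhds hlim
    (.of_forall fun ε => integral_nonneg fun l => by positivity) ?_
  filter_upwards [hscale.eventually_ge_atTop 1] with ε hε
  simpa only [inv_inv, Function.comp_apply] using integral_exp_mul_abs_sub_le hf (f 0) hb hε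

lemma tendsto_eLpNorm_scaledHeatKernel_sub {f : ℝ → ℝ} (hf : Integrable f)
    (hf0 : ContinuousAt f 0) {μ t : ℝ} (hμt : 0 < μ * t) (x : ℝ) :
    Tendsto (fun ε : ℝ =>
      eLpNorm (scaledHeatKernel f μ ε t x - scaledHeatKernel f μ 0 t x) 2 volume)
      (𝓝[>] 0) (𝓝 0) := by
  have hnorm (ε l : ℝ) : ‖(scaledHeatKernel f μ ε t x - scaledHeatKernel f μ 0 t x) l‖ ^ 2 ≤
      Real.exp (-(2 * (μ * t)) * l ^ 2) * |f (l * √ε) - f 0| := by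
    rw [scaledHeatKernel_zero, Pi.sub_apply, scaledHeatKernel, ← mul_sub, norm_mul, mul_pow,
      norm_heatKernelFourier_sq, ← Complex.ofReal_sub, Complex.norm_real, Real.norm_eq_abs, sq_abs]
    gcongr
    exact sq_sqrt_sub_sqrt_le_abs_sub _ _
  have hlim : Tendsto (fun ε : ℝ =>
      ∫ l, ‖(scaledHeatKernel f μ ε t x - scaledHeatKernel f μ 0 t x) l‖ ^ 2) (𝓝[>] 0) (𝓝 0) := by
    refine tendsto_of_tendsto_of_tendsto_of_le_of_le' tendsto_const_nhds
      (tendsto_integral_exp_mul_abs_sub hf hf0 hμt)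
      (.of_forall fun ε => integral_nonneg fun l => by positivity) ?_
    filter_upwards [self_mem_nhdsWithin] with ε hε
    refine integral_mono_of_nonneg (ae_of_all _ fun l => by positivity) ?_
      (ae_of_all _ (hnorm ε))
    exact integrable_exp_neg_mul_sq_mul_abs_sub (hf.comp_mul_right' (Real.sqrt_pos.2 hε).ne')
      (by positivity) (f 0)
  have hcont : Continuous fun a : ℝ => ENNReal.ofReal √a :=
    ENNReal.continuous_ofReal.comp Real.continuous_sqrt
  refine ((hcont.tendsto' 0 0 (by simp)).comp hlim).congr' ?_
  filter_upwards [self_mem_nhdsWithin] with ε hε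
  have hLp := (memLp_scaledHeatKernel hf hμt (le_of_lt hε) x).sub
    (memLp_scaledHeatKernel hf hμt le_rfl x)
  rw [hLp.eLpNorm_eq_integral_rpow_norm two_ne_zero (by simp)]
  simp only [ENNReal.toReal_ofNat, Real.rpow_ofNat, Function.comp_apply, Real.sqrt_eq_rpow,
    one_div]

end HeatKernel

section SquareIntegrable

variable {α β ι : Type*} [MeasurableSpace α] [MeasurableSpace β] {m : Measure α} {m' : Measure β}

lemma inner_toLp_eq_integral_mul_conj {𝕜 : Type*} [RCLike 𝕜] {u v : α → 𝕜} (hu : MemLp u 2 m)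
    (hv : MemLp v 2 m) :
    inner 𝕜 (hv.toLp v) (hu.toLp u) = ∫ a, u a * (starRingEnd 𝕜) (v a) ∂m := by
  rw [L2.inner_def]
  refine integral_congr_ae ?_
  filter_upwards [hu.coeFn_toLp, hv.coeFn_toLp] with a hua hva
  rw [hua, hva, RCLike.inner_apply]

lemma tendsto_integral_mul_conj {𝕜 : Type*} [RCLike 𝕜] {u v : ℕ → α → 𝕜} {u' v' : α → 𝕜}
    (hu : ∀ n, MemLp (u n) 2 m) (hv : ∀ n, MemLp (v n) 2 m) (hu' : MemLp u' 2 m)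
    (hv' : MemLp v' 2 m) (hulim : Tendsto (fun n => eLpNorm (u n - u') 2 m) atTop (𝓝 0))
    (hvlim : Tendsto (fun n => eLpNorm (v n - v') 2 m) atTop (𝓝 0)) :
    Tendsto (fun n => ∫ a, u n a * (starRingEnd 𝕜) (v n a) ∂m) atTop
      (𝓝 (∫ a, u' a * (starRingEnd 𝕜) (v' a) ∂m)) := by
  have huLp := (Lp.tendsto_Lp_iff_tendsto_eLpNorm'' u hu u' hu').2 hulim
  have hvLp := (Lp.tendsto_Lp_iff_tendsto_eLpNorm'' v hv v' hv').2 hvlim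
  simpa only [inner_toLp_eq_integral_mul_conj] using hvLp.inner (𝕜 := 𝕜) huLp

lemma integral_sum_mul_conj_sum {κ : Type*} {S : Finset ι} {T : Finset κ} {u : ι → α → ℂ}
    {v : κ → α → ℂ} (hu : ∀ i ∈ S, MemLp (u i) 2 m) (hv : ∀ j ∈ T, MemLp (v j) 2 m)
    (c : ι → ℂ) (d : κ → ℂ) :
    ∫ a, (∑ i ∈ S, c i * u i a) * (starRingEnd ℂ) (∑ j ∈ T, d j * v j a) ∂m =
      ∑ i ∈ S, ∑ j ∈ T,
        c i * (starRingEnd ℂ) (d j) * ∫ a, u i a * (starRingEnd ℂ) (v j a) ∂m := by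
  have hint (i : ι) (hi : i ∈ S) (j : κ) (hj : j ∈ T) :
      Integrable (fun a => c i * u i a * (starRingEnd ℂ) (d j * v j a)) m :=
    ((hu i hi).const_mul (c i)).integrable_mul ((hv j hj).const_mul (d j)).star
  simp_rw [map_sum, Finset.sum_mul_sum]
  rw [integral_finsetSum _ fun i hi => integrable_finsetSum _ (hint i hi)]
  refine Finset.sum_congr rfl fun i hi => ?_
  rw [integral_finsetSum _ (hint i hi)]
  refine Finset.sum_congr rfl fun j _ => ?_
  rw [← integral_const_mul]
  congr with a
  rw [map_mul]
  ring

lemma eLpNorm_two_eq_of_integral_mul_conj_eq {u : α → ℂ} {v : β → ℂ} (hu : MemLp u 2 m)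
    (hv : MemLp v 2 m')
    (huv : ∫ a, u a * (starRingEnd ℂ) (u a) ∂m = ∫ b, v b * (starRingEnd ℂ) (v b) ∂m') :
    eLpNorm u 2 m = eLpNorm v 2 m' := by
  simp_rw [Complex.mul_conj', ← Complex.ofReal_pow, integral_complex_ofReal,
    Complex.ofReal_inj] at huv
  rw [hu.eLpNorm_eq_integral_rpow_norm two_ne_zero (by simp),
    hv.eLpNorm_eq_integral_rpow_norm two_ne_zero (by simp)]
  simp only [ENNReal.toReal_ofNat, Real.rpow_ofNat, huv]

lemma eLpNorm_sum_eq_of_integral_mul_conj_eq [Fintype ι] {u : ι → α → ℂ} {v : ι → β → ℂ}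
    (hu : ∀ i, MemLp (u i) 2 m) (hv : ∀ i, MemLp (v i) 2 m')
    (huv : ∀ i j, ∫ a, u i a * (starRingEnd ℂ) (u j a) ∂m =
      ∫ b, v i b * (starRingEnd ℂ) (v j b) ∂m') (c : ι → ℂ) :
    eLpNorm (fun a => ∑ i, c i * u i a) 2 m = eLpNorm (fun b => ∑ i, c i * v i b) 2 m' := by
  refine eLpNorm_two_eq_of_integral_mul_conj_eq
    (memLp_finsetSum _ fun i _ => (hu i).const_mul (c i))
    (memLp_finsetSum _ fun i _ => (hv i).const_mul (c i)) ?_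
  rw [integral_sum_mul_conj_sum (fun i _ => hu i) (fun i _ => hu i),
    integral_sum_mul_conj_sum (fun i _ => hv i) (fun i _ => hv i)]
  simp_rw [huv]

lemma exists_seq_simpleFunc_tendsto_eLpNorm {g : α → ℂ} (hg : MemLp g 2 m) :
    ∃ s : ℕ → SimpleFunc α ℂ, (∀ n, MemLp (s n) 2 m) ∧
      Tendsto (fun n => eLpNorm (⇑(s n) - g) 2 m) atTop (𝓝 0) := by
  have happrox (n : ℕ) : ∃ s : SimpleFunc α ℂ,
      eLpNorm (g - ⇑s) 2 m < ((n : ℝ≥0∞) + 1)⁻¹ ∧ MemLp s 2 m :=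
    hg.exists_simpleFunc_eLpNorm_sub_lt (by simp) (by simp)
  choose s hs hsm using happrox
  have hrate : Tendsto (fun n : ℕ => ((n : ℝ≥0∞) + 1)⁻¹) atTop (𝓝 0) := by
    simpa using (tendsto_add_atTop_iff_nat 1).2 ENNReal.tendsto_inv_nat_nhds_zero
  refine ⟨s, hsm, tendsto_of_tendsto_of_tendsto_of_le_of_le tendsto_const_nhds hrate
    (fun _ => zero_le) fun n => ?_⟩
  rw [eLpNorm_sub_comm]
  exact (hs n).le

lemma exists_tendsto_eLpNorm_of_cauchy {u : ℕ → α → ℂ} {v : ℕ → β → ℂ} {v' : β → ℂ}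
    (hu : ∀ n, MemLp (u n) 2 m) (hv : ∀ n, MemLp (v n) 2 m') (hv' : MemLp v' 2 m')
    (huv : ∀ k n, eLpNorm (u k - u n) 2 m = eLpNorm (v k - v n) 2 m')
    (hlim : Tendsto (fun n => eLpNorm (v n - v') 2 m') atTop (𝓝 0)) :
    ∃ u' : α → ℂ, MemLp u' 2 m ∧ Tendsto (fun n => eLpNorm (u n - u') 2 m) atTop (𝓝 0) := by
  have hcauchy := ((Lp.tendsto_Lp_iff_tendsto_eLpNorm'' v hv v' hv').2 hlim).cauchySeq
  have hdist (k n : ℕ) : edist ((hu k).toLp) ((hu n).toLp) = edist ((hv k).toLp) ((hv n).toLp) := by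
    rw [Lp.edist_toLp_toLp, Lp.edist_toLp_toLp, huv]
  obtain ⟨U, hU⟩ : ∃ U, Tendsto (fun n => (hu n).toLp) atTop (𝓝 U) := by
    refine cauchySeq_tendsto_of_complete (EMetric.cauchySeq_iff.2 ?_)
    simpa only [hdist] using EMetric.cauchySeq_iff.1 hcauchy
  rw [← Lp.toLp_coeFn U (Lp.memLp U)] at hU
  exact ⟨U, Lp.memLp U, (Lp.tendsto_Lp_iff_tendsto_eLpNorm'' u hu U (Lp.memLp U)).1 hU⟩

end SquareIntegrable

section StochasticIntegral

variable {Ω : Type*} [MeasurableSpace Ω] {P : Measure Ω} {F : Measure ℝ} {Z : Set ℝ → Ω → ℂ}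

lemma IsGaussianRandomMeasure.memLp (hZ : IsGaussianRandomMeasure F Z P) {A : Set ℝ}
    (hA : MeasurableSet A) (hFA : F A < ∞) : MemLp (Z A) 2 P :=
  (hZ.gaussian.hasGaussianLaw_eval ⟨A, hA, hFA⟩).memLp_two

lemma IsGaussianRandomMeasure.integral_mul_conj (hZ : IsGaussianRandomMeasure F Z P) {A B : Set ℝ}
    (hA : MeasurableSet A) (hFA : F A < ∞) (hB : MeasurableSet B) (hFB : F B < ∞) :
    ∫ ω, Z A ω * (starRingEnd ℂ) (Z B ω) ∂P =
      ∫ l, A.indicator 1 l * (starRingEnd ℂ) (B.indicator 1 l) ∂F := by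
  have hprod (l : ℝ) : A.indicator (1 : ℝ → ℂ) l * (starRingEnd ℂ) (B.indicator 1 l) =
      (A ∩ B).indicator (fun _ => 1) l := by
    by_cases hlA : l ∈ A <;> by_cases hlB : l ∈ B <;> simp [hlA, hlB]
  simp_rw [hprod]
  rw [hZ.covariance A B hA hFA hB hFB, integral_indicator_const _ (hA.inter hB),
    Complex.real_smul, mul_one, Measure.real]

lemma measure_fiber_lt_top {s : SimpleFunc ℝ ℂ} (hs : MemLp s 2 F) {y : ℂ}
    (hy : y ∈ s.range.filter (· ≠ 0)) : F (s ⁻¹' {y}) < ∞ :=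
  s.measure_preimage_lt_top_of_memLp two_ne_zero (by simp) hs y (Finset.mem_filter.1 hy).2

lemma simpleIntegral_eq_sum_filter {Ω : Type*} (Z : Set ℝ → Ω → ℂ) (s : SimpleFunc ℝ ℂ) :
    simpleIntegral Z s = fun ω => ∑ y ∈ s.range with y ≠ 0, y * Z (s ⁻¹' {y}) ω := by
  funext ω
  rw [simpleIntegral, Finset.sum_filter_of_ne]
  exact fun y _ => left_ne_zero_of_mul

lemma simpleFunc_eq_sum_filter (s : SimpleFunc ℝ ℂ) (l : ℝ) :
    s l = ∑ y ∈ s.range with y ≠ 0, y * (s ⁻¹' {y}).indicator 1 l := by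
  rw [Finset.sum_filter_of_ne fun y _ => left_ne_zero_of_mul, Finset.sum_eq_single (s l)]
  · rw [Set.indicator_of_mem (by simp), Pi.one_apply, mul_one]
  · intro y _ hy
    rw [Set.indicator_of_notMem (by simpa using hy.symm), mul_zero]
  · exact fun hl => absurd (s.mem_range_self l) hl

lemma memLp_simpleIntegral (hZ : IsGaussianRandomMeasure F Z P) {s : SimpleFunc ℝ ℂ}
    (hs : MemLp s 2 F) : MemLp (simpleIntegral Z s) 2 P := by
  rw [simpleIntegral_eq_sum_filter]
  exact memLp_finsetSum _ fun y hy =>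
    (hZ.memLp (s.measurableSet_fiber y) (measure_fiber_lt_top hs hy)).const_mul y

lemma integral_simpleIntegral_mul_conj (hZ : IsGaussianRandomMeasure F Z P)
    {s r : SimpleFunc ℝ ℂ} (hs : MemLp s 2 F) (hr : MemLp r 2 F) :
    ∫ ω, simpleIntegral Z s ω * (starRingEnd ℂ) (simpleIntegral Z r ω) ∂P =
      ∫ l, s l * (starRingEnd ℂ) (r l) ∂F := by
  have hZmem {s : SimpleFunc ℝ ℂ} (hs : MemLp s 2 F) (y) (hy : y ∈ s.range.filter (· ≠ 0)) :
      MemLp (Z (s ⁻¹' {y})) 2 P :=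
    hZ.memLp (s.measurableSet_fiber y) (measure_fiber_lt_top hs hy)
  have hFmem {s : SimpleFunc ℝ ℂ} (hs : MemLp s 2 F) (y) (hy : y ∈ s.range.filter (· ≠ 0)) :
      MemLp ((s ⁻¹' {y}).indicator (1 : ℝ → ℂ)) 2 F :=
    memLp_indicator_const 2 (s.measurableSet_fiber y) 1 (.inr (measure_fiber_lt_top hs hy).ne)
  simp_rw +singlePass [simpleIntegral_eq_sum_filter, simpleFunc_eq_sum_filter]
  rw [integral_sum_mul_conj_sum (hZmem hs) (hZmem hr),
    integral_sum_mul_conj_sum (hFmem hs) (hFmem hr)]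
  refine Finset.sum_congr rfl fun y hy => Finset.sum_congr rfl fun z hz => ?_
  rw [hZ.integral_mul_conj (s.measurableSet_fiber y) (measure_fiber_lt_top hs hy)
    (r.measurableSet_fiber z) (measure_fiber_lt_top hr hz)]

lemma IsStochIntegral.integral_mul_conj (hZ : IsGaussianRandomMeasure F Z P) {g h : ℝ → ℂ}
    {X Y : Ω → ℂ} (hX : IsStochIntegral F Z P g X) (hY : IsStochIntegral F Z P h Y) :
    ∫ ω, X ω * (starRingEnd ℂ) (Y ω) ∂P = ∫ l, g l * (starRingEnd ℂ) (h l) ∂F := by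
  obtain ⟨hg, hXm, s, hs, hsg, hsX⟩ := hX
  obtain ⟨hh, hYm, r, hr, hrh, hrY⟩ := hY
  have hP := tendsto_integral_mul_conj (fun n => memLp_simpleIntegral hZ (hs n))
    (fun n => memLp_simpleIntegral hZ (hr n)) hXm hYm hsX hrY
  simp_rw [integral_simpleIntegral_mul_conj hZ (hs _) (hr _)] at hP
  exact tendsto_nhds_unique hP (tendsto_integral_mul_conj hs hr hg hh hsg hrh)

lemma IsStochIntegral.eLpNorm_sum (hZ : IsGaussianRandomMeasure F Z P) {ι : Type*} [Fintype ι]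
    {g : ι → ℝ → ℂ} {X : ι → Ω → ℂ} (hX : ∀ i, IsStochIntegral F Z P (g i) (X i)) (c : ι → ℂ) :
    eLpNorm (fun ω => ∑ i, c i * X i ω) 2 P = eLpNorm (fun l => ∑ i, c i * g i l) 2 F :=
  eLpNorm_sum_eq_of_integral_mul_conj_eq (fun i => (hX i).2.1) (fun i => (hX i).1)
    (fun i j => (hX i).integral_mul_conj hZ (hX j)) c

lemma IsStochIntegral.eLpNorm_sub (hZ : IsGaussianRandomMeasure F Z P) {g h : ℝ → ℂ}
    {X Y : Ω → ℂ} (hX : IsStochIntegral F Z P g X) (hY : IsStochIntegral F Z P h Y) :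
    eLpNorm (X - Y) 2 P = eLpNorm (g - h) 2 F := by
  have hXY : ∀ i, IsStochIntegral F Z P (![g, h] i) (![X, Y] i) := by
    simpa [Fin.forall_fin_two] using ⟨hX, hY⟩
  have hsum := IsStochIntegral.eLpNorm_sum hZ hXY ![1, -1]
  simp only [Fin.sum_univ_two] at hsum
  simpa [← sub_eq_add_neg, Pi.sub_def] using hsum

lemma IsStochIntegral.ae_eq_sum (hZ : IsGaussianRandomMeasure F Z P) {ι : Type*} [Fintype ι]
    {g : ι → ℝ → ℂ} {X : ι → Ω → ℂ} (hX : ∀ i, IsStochIntegral F Z P (g i) (X i)) {c : ι → ℂ}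
    {h : ℝ → ℂ} {Y : Ω → ℂ} (hY : IsStochIntegral F Z P h Y)
    (hh : h =ᵐ[F] fun l => ∑ i, c i * g i l) : Y =ᵐ[P] fun ω => ∑ i, c i * X i ω := by
  have hoption : ∀ o : Option ι, IsStochIntegral F Z P (o.elim h g) (o.elim Y X) :=
    Option.forall.2 ⟨hY, hX⟩
  have hnorm := IsStochIntegral.eLpNorm_sum hZ hoption fun o => o.elim 1 fun i => -c i
  simp only [Fintype.sum_option, Option.elim_none, Option.elim_some, one_mul, neg_mul,
    Finset.sum_neg_distrib, ← sub_eq_add_neg] at hnorm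
  have hzero : (fun l => h l - ∑ i, c i * g i l) =ᵐ[F] 0 := by
    filter_upwards [hh] with l hl
    rw [hl, sub_self, Pi.zero_apply]
  have hmeas : AEStronglyMeasurable (fun ω => Y ω - ∑ i, c i * X i ω) P :=
    (hY.2.1.sub (memLp_finsetSum _ fun i _ => (hX i).2.1.const_mul (c i))).1
  rw [eLpNorm_congr_ae hzero, eLpNorm_zero, eLpNorm_eq_zero_iff hmeas two_ne_zero] at hnorm
  filter_upwards [hnorm] with ω hω using sub_eq_zero.1 hω

lemma exists_isStochIntegral (hZ : IsGaussianRandomMeasure F Z P) {g : ℝ → ℂ}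
    (hg : MemLp g 2 F) : ∃ X, IsStochIntegral F Z P g X := by
  obtain ⟨s, hs, hsg⟩ := exists_seq_simpleFunc_tendsto_eLpNorm hg
  have hX (n : ℕ) : IsStochIntegral F Z P (s n) (simpleIntegral Z (s n)) := by
    refine ⟨hs n, memLp_simpleIntegral hZ (hs n), fun _ => s n, fun _ => hs n, ?_, ?_⟩ <;> simp
  obtain ⟨X, hXm, hlim⟩ := exists_tendsto_eLpNorm_of_cauchy
    (fun n => memLp_simpleIntegral hZ (hs n)) hs hg (fun k n => (hX k).eLpNorm_sub hZ (hX n)) hsg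
  exact ⟨X, hg, hXm, s, hs, hsg, hlim⟩

lemma isStochIntegral_stochIntegral (hZ : IsGaussianRandomMeasure F Z P) {g : ℝ → ℂ}
    (hg : MemLp g 2 F) : IsStochIntegral F Z P g (stochIntegral F Z P g) := by
  rw [stochIntegral, dif_pos (exists_isStochIntegral hZ hg)]
  exact (exists_isStochIntegral hZ hg).choose_spec

end StochasticIntegral

section GaussianLaw

variable {Ω Ω' : Type*} [MeasurableSpace Ω] [MeasurableSpace Ω'] {P : Measure Ω} {P' : Measure Ω'}

lemma tendsto_integral_of_tendsto_eLpNorm_two [IsProbabilityMeasure P] {E : Type*}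
    [NormedAddCommGroup E] [NormedSpace ℝ E] {X : ℕ → Ω → E} {Y : Ω → E}
    (hX : ∀ n, MemLp (X n) 2 P) (hY : MemLp Y 2 P)
    (hlim : Tendsto (fun n => eLpNorm (X n - Y) 2 P) atTop (𝓝 0)) :
    Tendsto (fun n => ∫ ω, X n ω ∂P) atTop (𝓝 (∫ ω, Y ω ∂P)) := by
  refine tendsto_integral_of_L1' Y hY.1 (.of_forall fun n => (hX n).integrable one_le_two) ?_
  exact tendsto_of_tendsto_of_tendsto_of_le_of_le tendsto_const_nhds hlim (fun _ => zero_le)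
    fun n => eLpNorm_le_eLpNorm_of_exponent_le one_le_two ((hX n).1.sub hY.1)

lemma tendsto_variance_of_tendsto_eLpNorm [IsProbabilityMeasure P] {X : ℕ → Ω → ℝ} {Y : Ω → ℝ}
    (hX : ∀ n, MemLp (X n) 2 P) (hY : MemLp Y 2 P)
    (hlim : Tendsto (fun n => eLpNorm (X n - Y) 2 P) atTop (𝓝 0)) :
    Tendsto (fun n => Var[X n; P]) atTop (𝓝 Var[Y; P]) := by
  have hsq := tendsto_integral_mul_conj hX hX hY hY hlim hlim
  simp_rw [conj_trivial, ← sq] at hsq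
  simp_rw [variance_eq_sub (hX _), variance_eq_sub hY]
  exact hsq.sub ((tendsto_integral_of_tendsto_eLpNorm_two hX hY hlim).pow 2)

lemma hasGaussianLaw_of_tendsto_eLpNorm [IsProbabilityMeasure P] {X : ℕ → Ω → ℝ} {Y : Ω → ℝ}
    (hX : ∀ n, HasGaussianLaw (X n) P) (hY : MemLp Y 2 P)
    (hlim : Tendsto (fun n => eLpNorm (X n - Y) 2 P) atTop (𝓝 0)) : HasGaussianLaw Y P := by
  have hXm (n : ℕ) : MemLp (X n) 2 P := (hX n).memLp_two
  have hmean := tendsto_integral_of_tendsto_eLpNorm_two hXm hY hlim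
  have hvar := tendsto_variance_of_tendsto_eLpNorm hXm hY hlim
  have hdist := (tendstoInMeasure_of_tendsto_eLpNorm two_ne_zero (fun n => (hXm n).1) hY.1
    hlim).tendstoInDistribution fun n => (hX n).aemeasurable
  rw [hasGaussianLaw_iff_charFun_map_eq hY.aemeasurable]
  intro t
  have hchar := ProbabilityMeasure.tendsto_iff_tendsto_charFun.1 hdist.tendsto t
  simp only [ProbabilityMeasure.coe_mk, (hX _).charFun_map_eq] at hchar
  refine tendsto_nhds_unique hchar ?_
  simp_rw [RCLike.inner_apply, conj_trivial, mul_comm _ t, integral_const_mul, variance_const_mul]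
  refine (Complex.continuous_exp.tendsto _).comp (Tendsto.sub ?_ ?_)
  · exact ((Complex.continuous_ofReal.tendsto _).comp (hmean.const_mul t)).mul_const _
  · exact ((Complex.continuous_ofReal.tendsto _).comp (hvar.const_mul (t ^ 2))).div_const _

lemma identDistrib_of_hasGaussianLaw {ι : Type*} [Finite ι] {X : Ω → ι → ℝ} {Y : Ω' → ι → ℝ}
    (hX : HasGaussianLaw X P) (hY : HasGaussianLaw Y P')
    (hmean : ∀ i, ∫ ω, X ω i ∂P = ∫ ω, Y ω i ∂P')
    (hcov : ∀ i j, cov[fun ω => X ω i, fun ω => X ω j; P] =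
      cov[fun ω => Y ω i, fun ω => Y ω j; P']) : IdentDistrib X Y P P' := by
  classical
  have := Fintype.ofFinite ι
  have := hX.isProbabilityMeasure
  have := hY.isProbabilityMeasure
  have := hX.isGaussian_map
  have := hY.isGaussian_map
  refine ⟨hX.aemeasurable, hY.aemeasurable, Measure.ext_of_charFunDual (funext fun L => ?_)⟩
  have hL (v : ι → ℝ) : L v = ∑ i, L (fun j => if i = j then 1 else 0) * v i := by
    simpa [mul_comm] using L.toLinearMap.pi_apply_eq_sum_univ v
  have hXi (i : ι) : MemLp (fun ω => X ω i) 2 P := (hX.eval i).memLp_two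
  have hYi (i : ι) : MemLp (fun ω => Y ω i) 2 P' := (hY.eval i).memLp_two
  rw [hX.charFunDual_map_eq_fun, hY.charFunDual_map_eq_fun]
  simp only [hL (X _), hL (Y _)]
  rw [variance_fun_sum fun i => (hXi i).const_mul _, variance_fun_sum fun i => (hYi i).const_mul _,
    integral_finsetSum _ fun i _ => ((hXi i).integrable one_le_two).const_mul _,
    integral_finsetSum _ fun i _ => ((hYi i).integrable one_le_two).const_mul _]
  simp_rw [integral_const_mul, covariance_const_mul_left, covariance_const_mul_right, hmean, hcov]

end GaussianLaw

section StochasticIntegralLaw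

variable {Ω : Type*} [MeasurableSpace Ω] {P : Measure Ω} {F : Measure ℝ} {Z : Set ℝ → Ω → ℂ}

lemma IsGaussianRandomMeasure.isNegInvariant [IsFiniteMeasure F]
    (hZ : IsGaussianRandomMeasure F Z P) : F.IsNegInvariant := by
  refine ⟨Measure.ext fun A hA => ?_⟩
  have hneg : MeasurableSet (Neg.neg ⁻¹' A) := measurable_neg hA
  have hsecond : ∫ ω, Z (Neg.neg ⁻¹' A) ω * (starRingEnd ℂ) (Z (Neg.neg ⁻¹' A) ω) ∂P =
      ∫ ω, Z A ω * (starRingEnd ℂ) (Z A ω) ∂P := by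
    refine integral_congr_ae ?_
    filter_upwards [hZ.hermitian A hA (measure_lt_top F A)] with ω hω
    rw [hω, Complex.conj_conj, mul_comm]
  rw [hZ.covariance _ _ hneg (measure_lt_top F _) hneg (measure_lt_top F _),
    hZ.covariance _ _ hA (measure_lt_top F _) hA (measure_lt_top F _), Set.inter_self,
    Set.inter_self, Complex.ofReal_inj,
    ENNReal.toReal_eq_toReal_iff' (measure_ne_top F _) (measure_ne_top F _)] at hsecond
  rwa [Measure.neg, Measure.map_apply measurable_neg hA]

lemma IsStochIntegral.ae_eq (hZ : IsGaussianRandomMeasure F Z P) {g h : ℝ → ℂ} {X Y : Ω → ℂ}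
    (hX : IsStochIntegral F Z P g X) (hY : IsStochIntegral F Z P h Y) (hgh : g =ᵐ[F] h) :
    X =ᵐ[P] Y := by
  have hnorm : eLpNorm (X - Y) 2 P = 0 := by
    rw [hX.eLpNorm_sub hZ hY]
    exact (eLpNorm_congr_ae ((sub_ae_eq_zero _ _).2 hgh)).trans eLpNorm_zero
  rw [eLpNorm_eq_zero_iff (hX.2.1.1.sub hY.2.1.1) two_ne_zero] at hnorm
  exact (sub_ae_eq_zero _ _).1 hnorm

lemma simpleIntegral_conj_comp_neg (hZ : IsGaussianRandomMeasure F Z P) {s r : SimpleFunc ℝ ℂ}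
    (hs : MemLp s 2 F) (hr : ∀ l, r l = (starRingEnd ℂ) (s (-l))) :
    ∀ᵐ ω ∂P, simpleIntegral Z r ω = (starRingEnd ℂ) (simpleIntegral Z s ω) := by
  have hfiber (y : ℂ) : r ⁻¹' {(starRingEnd ℂ) y} = Neg.neg ⁻¹' (s ⁻¹' {y}) := by
    ext l
    simp only [Set.mem_preimage, Set.mem_singleton_iff, hr]
    exact (starRingEnd ℂ).injective.eq_iff
  have hrange : r.range = s.range.image (starRingEnd ℂ) := by
    ext y
    simp only [SimpleFunc.mem_range, Finset.mem_image, Set.mem_range, hr,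
      exists_exists_eq_and]
    exact ⟨fun ⟨l, hl⟩ => ⟨-l, hl⟩, fun ⟨l, hl⟩ => ⟨-l, by rw [neg_neg, hl]⟩⟩
  have hherm : ∀ᵐ ω ∂P, ∀ y ∈ s.range.filter (· ≠ 0),
      Z (Neg.neg ⁻¹' (s ⁻¹' {y})) ω = (starRingEnd ℂ) (Z (s ⁻¹' {y}) ω) := by
    rw [eventually_all_finset]
    exact fun y hy => hZ.hermitian _ (s.measurableSet_fiber y) (measure_fiber_lt_top hs hy)
  filter_upwards [hherm] with ω hω
  rw [simpleIntegral, hrange, Finset.sum_image (starRingEnd ℂ).injective.injOn, simpleIntegral,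
    map_sum]
  refine Finset.sum_congr rfl fun y hy => ?_
  rcases eq_or_ne y 0 with rfl | hy0
  · rw [map_zero, zero_mul, zero_mul, map_zero]
  · rw [hfiber, hω y (Finset.mem_filter.2 ⟨hy, hy0⟩), map_mul]

lemma IsStochIntegral.conj_comp_neg [F.IsNegInvariant] (hZ : IsGaussianRandomMeasure F Z P)
    {g : ℝ → ℂ} {X : Ω → ℂ} (hX : IsStochIntegral F Z P g X) :
    IsStochIntegral F Z P (fun l => (starRingEnd ℂ) (g (-l))) (fun ω => (starRingEnd ℂ) (X ω)) := by
  have hneg := Measure.measurePreserving_neg F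
  have hmem {f : ℝ → ℂ} (hf : MemLp f 2 F) : MemLp (fun l => (starRingEnd ℂ) (f (-l))) 2 F :=
    (hf.comp_measurePreserving hneg).star
  obtain ⟨hg, hXm, s, hs, hsg, hsX⟩ := hX
  let r (n : ℕ) : SimpleFunc ℝ ℂ := ((s n).comp Neg.neg measurable_neg).map (starRingEnd ℂ)
  have hr (n : ℕ) (l : ℝ) : r n l = (starRingEnd ℂ) (s n (-l)) := rfl
  refine ⟨hmem hg, hXm.star, r, fun n => hmem (hs n), hsg.congr fun n => ?_,
    hsX.congr fun n => ?_⟩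
  · refine (eLpNorm_comp_measurePreserving ((hs n).1.sub hg.1) hneg).symm.trans ?_
    refine eLpNorm_congr_norm_ae (ae_of_all _ fun l => ?_)
    rw [hr, ← map_sub, RCLike.norm_conj]
    rfl
  · refine eLpNorm_congr_norm_ae ?_
    filter_upwards [simpleIntegral_conj_comp_neg hZ (hs n) (hr n)] with ω hω
    rw [hω, ← map_sub, RCLike.norm_conj]

lemma IsStochIntegral.eq_ofReal_re [F.IsNegInvariant] (hZ : IsGaussianRandomMeasure F Z P)
    {g : ℝ → ℂ} {X : Ω → ℂ} (hX : IsStochIntegral F Z P g X)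
    (hg : ∀ l, g (-l) = (starRingEnd ℂ) (g l)) : ∀ᵐ ω ∂P, X ω = ((X ω).re : ℂ) := by
  have hconj := hX.conj_comp_neg hZ
  simp_rw [hg, Complex.conj_conj] at hconj
  filter_upwards [hconj.ae_eq hZ hX .rfl] with ω hω
  exact (Complex.conj_eq_iff_re.1 hω).symm

lemma hasGaussianLaw_simpleIntegral_re (hZ : IsGaussianRandomMeasure F Z P)
    {s : SimpleFunc ℝ ℂ} (hs : MemLp s 2 F) :
    HasGaussianLaw (fun ω => (simpleIntegral Z s ω).re) P := by
  let fiber (y : s.range.filter (· ≠ 0)) : {A : Set ℝ // MeasurableSet A ∧ F A < ∞} :=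
    ⟨s ⁻¹' {y.1}, s.measurableSet_fiber y.1, measure_fiber_lt_top hs y.2⟩
  have hsum := ((hZ.gaussian.comp_right fiber).comp_left
    (fun y => ContinuousLinearMap.mul ℝ ℂ y.1)).hasGaussianLaw_fun_sum (I := Finset.univ)
  refine (hsum.map_fun Complex.reCLM).congr (ae_of_all _ fun ω => ?_)
  simp only [Complex.reCLM_apply, simpleIntegral_eq_sum_filter]
  exact congrArg Complex.re (Finset.sum_coe_sort _ fun y => y * Z (s ⁻¹' {y}) ω)

lemma integral_simpleIntegral (hZ : IsGaussianRandomMeasure F Z P)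
    {s : SimpleFunc ℝ ℂ} (hs : MemLp s 2 F) : ∫ ω, simpleIntegral Z s ω ∂P = 0 := by
  have := hZ.gaussian.isProbabilityMeasure
  rw [simpleIntegral_eq_sum_filter, integral_finsetSum _ fun y hy => ((hZ.memLp
    (s.measurableSet_fiber y) (measure_fiber_lt_top hs hy)).integrable one_le_two).const_mul y]
  refine Finset.sum_eq_zero fun y hy => ?_
  rw [integral_const_mul, hZ.mean_zero _ (s.measurableSet_fiber y) (measure_fiber_lt_top hs hy),
    mul_zero]

lemma IsStochIntegral.integral_re (hZ : IsGaussianRandomMeasure F Z P) {g : ℝ → ℂ} {X : Ω → ℂ}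
    (hX : IsStochIntegral F Z P g X) : ∫ ω, (X ω).re ∂P = 0 := by
  have := hZ.gaussian.isProbabilityMeasure
  obtain ⟨-, hXm, s, hs, -, hsX⟩ := hX
  have hmean := tendsto_integral_of_tendsto_eLpNorm_two (fun n => memLp_simpleIntegral hZ (hs n))
    hXm hsX
  simp_rw [integral_simpleIntegral hZ (hs _)] at hmean
  have hzero : ∫ ω, X ω ∂P = 0 := tendsto_nhds_unique hmean tendsto_const_nhds
  exact (_root_.integral_re (hXm.integrable one_le_two)).trans (by rw [hzero, map_zero])

lemma IsStochIntegral.hasGaussianLaw_re (hZ : IsGaussianRandomMeasure F Z P) {g : ℝ → ℂ}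
    {X : Ω → ℂ} (hX : IsStochIntegral F Z P g X) : HasGaussianLaw (fun ω => (X ω).re) P := by
  have := hZ.gaussian.isProbabilityMeasure
  obtain ⟨-, hXm, s, hs, -, hsX⟩ := hX
  refine hasGaussianLaw_of_tendsto_eLpNorm (fun n => hasGaussianLaw_simpleIntegral_re hZ (hs n))
    hXm.re ?_
  refine tendsto_of_tendsto_of_tendsto_of_le_of_le tendsto_const_nhds hsX (fun _ => zero_le)
    fun n => eLpNorm_mono fun ω => ?_
  rw [Pi.sub_apply, ← Complex.sub_re]
  exact Complex.abs_re_le_norm _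

lemma IsStochIntegral.hasGaussianLaw_re_pi (hZ : IsGaussianRandomMeasure F Z P) {ι : Type*}
    [Finite ι] {g : ι → ℝ → ℂ} {X : ι → Ω → ℂ} (hX : ∀ i, IsStochIntegral F Z P (g i) (X i)) :
    HasGaussianLaw (fun ω i => (X i ω).re) P := by
  classical
  have := Fintype.ofFinite ι
  have hmeas : AEMeasurable (fun ω i => (X i ω).re) P :=
    aemeasurable_pi_lambda _ fun i => ((hX i).hasGaussianLaw_re hZ).aemeasurable
  refine ⟨isGaussian_of_isGaussian_map fun L => ?_⟩
  rw [AEMeasurable.map_map_of_aemeasurable (by fun_prop) hmeas]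
  refine HasGaussianLaw.isGaussian_map ?_
  have hL (v : ι → ℝ) : L v = ∑ i, L (fun j => if i = j then 1 else 0) * v i := by
    simpa [mul_comm] using L.toLinearMap.pi_apply_eq_sum_univ v
  have hG : MemLp (fun l => ∑ i, (L (fun j => if i = j then 1 else 0) : ℂ) * g i l) 2 F :=
    memLp_finsetSum _ fun i _ => (hX i).1.const_mul _
  have hY := isStochIntegral_stochIntegral hZ hG
  refine (hY.hasGaussianLaw_re hZ).congr ?_
  filter_upwards [IsStochIntegral.ae_eq_sum hZ hX hY .rfl] with ω hω
  rw [hω, Complex.re_sum, Function.comp_apply, hL]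
  simp_rw [Complex.re_ofReal_mul]

lemma IsStochIntegral.covariance_re [F.IsNegInvariant] (hZ : IsGaussianRandomMeasure F Z P)
    {g h : ℝ → ℂ} {X Y : Ω → ℂ} (hX : IsStochIntegral F Z P g X) (hY : IsStochIntegral F Z P h Y)
    (hg : ∀ l, g (-l) = (starRingEnd ℂ) (g l)) (hh : ∀ l, h (-l) = (starRingEnd ℂ) (h l)) :
    (cov[fun ω => (X ω).re, fun ω => (Y ω).re; P] : ℂ) =
      ∫ l, g l * (starRingEnd ℂ) (h l) ∂F := by
  have := hZ.gaussian.isProbabilityMeasure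
  rw [covariance_eq_sub (hX.hasGaussianLaw_re hZ).memLp_two (hY.hasGaussianLaw_re hZ).memLp_two,
    ← hX.integral_mul_conj hZ hY, hX.integral_re hZ,
    zero_mul, sub_zero, ← integral_complex_ofReal]
  refine integral_congr_ae ?_
  filter_upwards [hX.eq_ofReal_re hZ hg, hY.eq_ofReal_re hZ hh] with ω hXω hYω
  rw [hXω, hYω, Complex.conj_ofReal, ← Complex.ofReal_mul]
  rfl

end StochasticIntegralLaw

section StochasticFubini

variable {α Ω : Type*} [MeasurableSpace α] [MeasurableSpace Ω] {m : Measure α} {P : Measure Ω}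
  {F : Measure ℝ} {Z : Set ℝ → Ω → ℂ}

lemma memLp_two_uncurry [SFinite P] {u : α → Ω → ℂ}
    (hum : AEStronglyMeasurable (Function.uncurry u) (m.prod P)) (hu : ∀ y, MemLp (u y) 2 P)
    (hint : Integrable (fun y => ∫ ω, ‖u y ω‖ ^ 2 ∂P) m) :
    MemLp (Function.uncurry u) 2 (m.prod P) := by
  rw [memLp_two_iff_integrable_sq_norm hum]
  refine (integrable_prod_iff (hum.norm.pow 2)).2
    ⟨ae_of_all _ fun y => (memLp_two_iff_integrable_sq_norm (hu y).1).1 (hu y), ?_⟩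
  simpa only [Function.uncurry, Pi.pow_apply, norm_pow, norm_norm] using hint

lemma norm_integral_sq_le_integral_norm_sq [IsProbabilityMeasure m] {v : α → ℂ}
    (hv : MemLp v 2 m) : ‖∫ y, v y ∂m‖ ^ 2 ≤ ∫ y, ‖v y‖ ^ 2 ∂m := by
  have hvar := variance_nonneg (fun y => ‖v y‖) m
  rw [variance_eq_sub hv.norm, sub_nonneg] at hvar
  calc ‖∫ y, v y ∂m‖ ^ 2 ≤ (∫ y, ‖v y‖ ∂m) ^ 2 := by
        gcongr
        exact norm_integral_le_integral_norm v
    _ ≤ ∫ y, ‖v y‖ ^ 2 ∂m := hvar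

lemma memLp_two_integral_left [IsProbabilityMeasure m] [IsFiniteMeasure P] {u : α → Ω → ℂ}
    (hu : MemLp (Function.uncurry u) 2 (m.prod P)) : MemLp (fun ω => ∫ y, u y ω ∂m) 2 P := by
  have hsq := (memLp_two_iff_integrable_sq_norm hu.1).1 hu
  have hmeas : AEStronglyMeasurable (fun ω => ∫ y, u y ω ∂m) P :=
    (hu.integrable one_le_two).integral_prod_right.1
  rw [memLp_two_iff_integrable_sq_norm hmeas]
  refine hsq.integral_prod_right.mono' (hmeas.norm.pow 2) ?_
  filter_upwards [hsq.prod_left_ae, hu.1.prodMk_right] with ω hω hωm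
  rw [Real.norm_of_nonneg (by positivity)]
  exact norm_integral_sq_le_integral_norm_sq ((memLp_two_iff_integrable_sq_norm hωm).2 hω)

lemma integral_integral_mul_conj [IsFiniteMeasure m] [SFinite P] {u : α → Ω → ℂ} {v : Ω → ℂ}
    (hu : MemLp (Function.uncurry u) 2 (m.prod P)) (hv : MemLp v 2 P) :
    ∫ ω, (∫ y, u y ω ∂m) * (starRingEnd ℂ) (v ω) ∂P =
      ∫ y, ∫ ω, u y ω * (starRingEnd ℂ) (v ω) ∂P ∂m := by
  simp_rw [← integral_mul_const]
  exact (integral_integral_swap (hu.integrable_mul (hv.star.comp_snd m))).symm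

lemma IsStochIntegral.congr_ae {g : ℝ → ℂ} {X Y : Ω → ℂ} (hX : IsStochIntegral F Z P g X)
    (hXY : X =ᵐ[P] Y) : IsStochIntegral F Z P g Y := by
  obtain ⟨hg, hXm, s, hs, hsg, hsX⟩ := hX
  refine ⟨hg, hXm.ae_eq hXY, s, hs, hsg, hsX.congr fun n => eLpNorm_congr_ae ?_⟩
  filter_upwards [hXY] with ω hω
  rw [hω]

lemma IsStochIntegral.memLp_uncurry [SFinite F] (hZ : IsGaussianRandomMeasure F Z P)
    {g : α → ℝ → ℂ} {X : α → Ω → ℂ} (hX : ∀ y, IsStochIntegral F Z P (g y) (X y))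
    (hXm : AEStronglyMeasurable (Function.uncurry X) (m.prod P))
    (hg : MemLp (Function.uncurry g) 2 (m.prod F)) :
    MemLp (Function.uncurry X) 2 (m.prod P) := by
  have := hZ.gaussian.isProbabilityMeasure
  have hnorm (y : α) : ∫ ω, ‖X y ω‖ ^ 2 ∂P = ∫ l, ‖g y l‖ ^ 2 ∂F := by
    have hiso := (hX y).integral_mul_conj hZ (hX y)
    simp_rw [Complex.mul_conj', ← Complex.ofReal_pow, integral_complex_ofReal] at hiso
    exact Complex.ofReal_inj.1 hiso
  refine memLp_two_uncurry hXm (fun y => (hX y).2.1) ?_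
  simp_rw [hnorm]
  exact ((memLp_two_iff_integrable_sq_norm hg.1).1 hg).integral_prod_left

/-- The difference of the two sides is orthogonal to every stochastic integral, hence also to the
mixture `∫ y, X y ∂m`, and therefore to itself. -/
lemma IsStochIntegral.integral_ae_eq [IsProbabilityMeasure m] [SFinite F]
    (hZ : IsGaussianRandomMeasure F Z P) {g : α → ℝ → ℂ} {X : α → Ω → ℂ} {Y : Ω → ℂ}
    (hX : ∀ y, IsStochIntegral F Z P (g y) (X y))
    (hXm : AEStronglyMeasurable (Function.uncurry X) (m.prod P))
    (hg : MemLp (Function.uncurry g) 2 (m.prod F))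
    (hY : IsStochIntegral F Z P (fun l => ∫ y, g y l ∂m) Y) :
    (fun ω => ∫ y, X y ω ∂m) =ᵐ[P] Y := by
  have := hZ.gaussian.isProbabilityMeasure
  have hXu := IsStochIntegral.memLp_uncurry hZ hX hXm hg
  have hJ := memLp_two_integral_left hXu
  set J : Ω → ℂ := fun ω => ∫ y, X y ω ∂m
  have hD : MemLp (J - Y) 2 P := hJ.sub hY.2.1
  have hDsub {V : Ω → ℂ} (hV : MemLp V 2 P) : ∫ ω, (J - Y) ω * (starRingEnd ℂ) (V ω) ∂P =
      ∫ ω, J ω * (starRingEnd ℂ) (V ω) ∂P - ∫ ω, Y ω * (starRingEnd ℂ) (V ω) ∂P := by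
    simp_rw [Pi.sub_apply, sub_mul]
    exact integral_sub (hJ.integrable_mul hV.star) (hY.2.1.integrable_mul hV.star)
  have horth {h : ℝ → ℂ} {V : Ω → ℂ} (hV : IsStochIntegral F Z P h V) :
      ∫ ω, V ω * (starRingEnd ℂ) ((J - Y) ω) ∂P = 0 := by
    have hDV : ∫ ω, (J - Y) ω * (starRingEnd ℂ) (V ω) ∂P = 0 := by
      rw [hDsub hV.2.1, integral_integral_mul_conj hXu hV.2.1, hY.integral_mul_conj hZ hV,
        integral_integral_mul_conj hg hV.1, sub_eq_zero]
      simp_rw [(hX _).integral_mul_conj hZ hV]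
    rw [← map_zero (starRingEnd ℂ), ← hDV, ← integral_conj]
    simp_rw [map_mul, Complex.conj_conj, mul_comm]
  have hDD : ∫ ω, (J - Y) ω * (starRingEnd ℂ) ((J - Y) ω) ∂P = 0 := by
    rw [hDsub hD, integral_integral_mul_conj hXu hD, horth hY, sub_zero]
    simp_rw [horth (hX _), integral_zero]
  have hnorm := eLpNorm_two_eq_of_integral_mul_conj_eq hD (MemLp.zero (μ := P) (ε := ℂ))
    (by simpa using hDD)
  rw [eLpNorm_zero, eLpNorm_eq_zero_iff hD.1 two_ne_zero] at hnorm
  exact (sub_ae_eq_zero _ _).1 hnorm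

end StochasticFubini

section InitialCondition

variable {Ω : Type*} [MeasurableSpace Ω] {P : Measure Ω} {F : Measure ℝ} {Z : Set ℝ → Ω → ℂ}
  {η : ℝ → Ω → ℝ}

lemma integral_withDensity_ofReal {α : Type*} [MeasurableSpace α] {m : Measure α} {f : α → ℝ}
    (hf : AEMeasurable f m) (hf0 : 0 ≤ᵐ[m] f) (g : α → ℂ) :
    ∫ a, g a ∂(m.withDensity fun a => ENNReal.ofReal (f a)) = ∫ a, (f a : ℂ) * g a ∂m := by
  rw [integral_withDensity_eq_integral_toReal_smul₀ hf.ennreal_ofReal (by simp)]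
  refine integral_congr_ae ?_
  filter_upwards [hf0] with a ha
  rw [ENNReal.toReal_ofReal ha, Complex.real_smul]

lemma memLp_heatKernelFourier_of_isFiniteMeasure [IsFiniteMeasure F] {μ t : ℝ}
    (hμt : 0 ≤ μ * t) (x : ℝ) : MemLp (heatKernelFourier μ t x) 2 F :=
  .of_bound (continuous_heatKernelFourier μ t x).aestronglyMeasurable 1
    (ae_of_all _ (norm_heatKernelFourier_le_one hμt x))

lemma heatKernelFourier_time_zero (μ x : ℝ) :
    heatKernelFourier μ 0 x = fun l : ℝ => Complex.exp (Complex.I * l * x) := by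
  funext l
  simp [heatKernelFourier]

lemma charFun_eq_covariance [IsFiniteMeasure F] (hZ : IsGaussianRandomMeasure F Z P)
    (hη : ∀ x, IsStochIntegral F Z P (heatKernelFourier 0 0 x) fun ω => (η x ω : ℂ)) (x : ℝ) :
    charFun F x = cov[η 0, η x; P] := by
  have := hZ.isNegInvariant
  have hcov := (hη x).covariance_re hZ (hη 0) (heatKernelFourier_neg 0 0 x)
    (heatKernelFourier_neg 0 0 0)
  simp only [Complex.ofReal_re] at hcov
  rw [covariance_comm, hcov, charFun_apply_real]
  simp_rw [heatKernelFourier_time_zero]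
  refine integral_congr_ae (ae_of_all _ fun l => ?_)
  simp only [Complex.ofReal_zero, mul_zero, Complex.exp_zero, map_one, mul_one]
  ring_nf

lemma controlMeasure_eq_withDensity_specDensity [IsFiniteMeasure F]
    (hZ : IsGaussianRandomMeasure F Z P) {κ w : ℝ} (hκ : 0 < κ) (hodd : ∀ n : ℕ, κ ≠ 2 * n + 1)
    (hη : ∀ x, IsStochIntegral F Z P (heatKernelFourier 0 0 x) fun ω => (η x ω : ℂ))
    (hcov : ∀ x : ℝ, cov[η 0, η x; P] = Real.cos (w * x) / (1 + x ^ 2) ^ (κ / 2)) :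
    F = volume.withDensity fun l => ENNReal.ofReal (specDensity κ w l) := by
  have hint := integrable_specDensity hκ hodd w
  have := isFiniteMeasure_withDensity_ofReal hint.2
  refine Measure.ext_of_charFun (funext fun x => ?_)
  rw [charFun_eq_covariance hZ hη, hcov, charFun_apply_real, integral_withDensity_ofReal
    hint.aemeasurable (specDensity_nonneg_ae hκ hodd w), ← integral_specDensity_mul_exp hκ hodd]
  simp_rw [mul_comm Complex.I, mul_right_comm _ Complex.I]

lemma integral_heatKernelFourier_gaussianReal {μ t : ℝ} (hμt : 0 ≤ μ * t) (x l : ℝ) :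
    ∫ y, heatKernelFourier 0 0 y l ∂(gaussianReal x (2 * (μ * t)).toNNReal) =
      heatKernelFourier μ t x l := by
  have hchar := charFun_gaussianReal (μ := x) (v := (2 * (μ * t)).toNNReal) l
  rw [charFun_apply_real, Real.coe_toNNReal _ (by positivity)] at hchar
  have hexp (y : ℝ) : heatKernelFourier 0 0 y l = Complex.exp (l * y * Complex.I) := by
    rw [heatKernelFourier_time_zero]
    ring_nf
  simp_rw [hexp]
  rw [hchar, heatKernelFourier]
  congr 1
  push_cast
  ring

lemma gaussianPDFReal_two_mul {μ t : ℝ} (hμt : 0 ≤ μ * t) (x y : ℝ) :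
    gaussianPDFReal x (2 * (μ * t)).toNNReal y =
      1 / √(4 * Real.pi * μ * t) * Real.exp (-(x - y) ^ 2 / (4 * μ * t)) := by
  rw [gaussianPDFReal, Real.coe_toNNReal _ (by positivity), one_div]
  ring_nf

lemma integral_gaussianReal_eq_integral_exp {μ t : ℝ} (hμt : 0 < μ * t) (x : ℝ) (h : ℝ → ℝ) :
    ∫ y, h y ∂(gaussianReal x (2 * (μ * t)).toNNReal) =
      1 / √(4 * Real.pi * μ * t) * ∫ y, h y * Real.exp (-(x - y) ^ 2 / (4 * μ * t)) := by
  rw [integral_gaussianReal_eq_integral_smul (by simpa using hμt), ← integral_const_mul]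
  simp_rw [gaussianPDFReal_two_mul hμt.le, smul_eq_mul, mul_assoc, mul_comm (h _)]

lemma integrable_mul_exp_of_integrable_gaussianReal {μ t : ℝ} (hμt : 0 < μ * t) {x : ℝ}
    {h : ℝ → ℝ} (hint : Integrable h (gaussianReal x (2 * (μ * t)).toNNReal)) :
    Integrable fun y => h y * Real.exp (-(x - y) ^ 2 / (4 * μ * t)) := by
  have hsqrt : √(4 * Real.pi * μ * t) ≠ 0 := by
    have := Real.pi_pos
    exact (Real.sqrt_pos.2 (by nlinarith)).ne'
  rw [gaussianReal_of_var_ne_zero _ (by simpa using hμt),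
    integrable_withDensity_iff_integrable_smul' (measurable_gaussianPDF _ _)
      (ae_of_all _ fun _ => gaussianPDF_lt_top)] at hint
  simp_rw [toReal_gaussianPDF, gaussianPDFReal_two_mul hμt.le] at hint
  refine (hint.const_mul √(4 * Real.pi * μ * t)).congr (ae_of_all _ fun y => ?_)
  simp only [smul_eq_mul]
  field_simp

lemma solution_eq_integral_gaussianReal [IsFiniteMeasure F] (hZ : IsGaussianRandomMeasure F Z P)
    (hη : ∀ x, IsStochIntegral F Z P (heatKernelFourier 0 0 x) fun ω => (η x ω : ℂ))
    (hηm : Measurable (Function.uncurry η)) {μ t : ℝ} (hμt : 0 ≤ μ * t) (x : ℝ) :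
    ∀ᵐ ω ∂P, Integrable (fun y => η y ω) (gaussianReal x (2 * (μ * t)).toNNReal) ∧
      solution F Z P μ t x ω = ∫ y, η y ω ∂(gaussianReal x (2 * (μ * t)).toNNReal) := by
  have := hZ.gaussian.isProbabilityMeasure
  set m := gaussianReal x (2 * (μ * t)).toNNReal
  have hXm : AEStronglyMeasurable (Function.uncurry fun y ω => (η y ω : ℂ)) (m.prod P) :=
    (Complex.measurable_ofReal.comp hηm).aestronglyMeasurable
  have hg : MemLp (Function.uncurry (heatKernelFourier 0 0)) 2 (m.prod F) := by
    refine .of_bound (Continuous.aestronglyMeasurable ?_) 1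
      (ae_of_all _ fun p => norm_heatKernelFourier_le_one (by simp) _ _)
    unfold Function.uncurry heatKernelFourier
    fun_prop
  have hu : IsStochIntegral F Z P (fun l => ∫ y, heatKernelFourier 0 0 y l ∂m)
      (solutionC F Z P μ t x) := by
    simp_rw [m, integral_heatKernelFourier_gaussianReal hμt]
    exact isStochIntegral_stochIntegral hZ (memLp_heatKernelFourier_of_isFiniteMeasure hμt x)
  have hint := (IsStochIntegral.memLp_uncurry hZ hη hXm hg).integrable one_le_two
  filter_upwards [hint.prod_left_ae, IsStochIntegral.integral_ae_eq hZ hη hXm hg hu] with ω hω hωu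
  refine ⟨hω.re.congr (by simp), ?_⟩
  rw [solution, ← hωu, integral_complex_ofReal, Complex.ofReal_re]

lemma solution_eq_heatSemigroup [IsFiniteMeasure F] (hZ : IsGaussianRandomMeasure F Z P)
    (hη : ∀ x, IsStochIntegral F Z P (heatKernelFourier 0 0 x) fun ω => (η x ω : ℂ))
    (hηm : Measurable (Function.uncurry η)) {μ t : ℝ} (hμt : 0 < μ * t) (x : ℝ) :
    ∀ᵐ ω ∂P, Integrable (fun y => η y ω * Real.exp (-(x - y) ^ 2 / (4 * μ * t))) ∧
      solution F Z P μ t x ω =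
        1 / √(4 * Real.pi * μ * t) * ∫ y, η y ω * Real.exp (-(x - y) ^ 2 / (4 * μ * t)) := by
  filter_upwards [solution_eq_integral_gaussianReal hZ hη hηm hμt.le x] with ω ⟨hint, hω⟩
  exact ⟨integrable_mul_exp_of_integrable_gaussianReal hμt hint,
    by rw [hω, integral_gaussianReal_eq_integral_exp hμt]⟩

end InitialCondition

section RandomVector

variable {Ω ι : Type*} [MeasurableSpace Ω] {P : Measure Ω}

lemma eLpNorm_pi_le_sum [Fintype ι] {E : ι → Type*} [∀ i, NormedAddCommGroup (E i)]
    {X : Ω → ∀ i, E i} (hX : ∀ i, AEStronglyMeasurable (fun ω => X ω i) P) {p : ℝ≥0∞} (hp : 1 ≤ p) :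
    eLpNorm X p P ≤ ∑ i, eLpNorm (fun ω => X ω i) p P := by
  calc eLpNorm X p P ≤ eLpNorm (∑ i, fun ω => ‖X ω i‖) p P := by
        refine eLpNorm_mono_real fun ω => ?_
        rw [Finset.sum_apply]
        rw [pi_norm_le_iff_of_nonneg (Finset.sum_nonneg fun i _ => norm_nonneg _)]
        intro i
        exact Finset.single_le_sum (f := fun i => ‖X ω i‖) (fun i _ => norm_nonneg _)
          (Finset.mem_univ i)
    _ ≤ ∑ i, eLpNorm (fun ω => ‖X ω i‖) p P := eLpNorm_sum_le (fun i _ => (hX i).norm) hp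
    _ = ∑ i, eLpNorm (fun ω => X ω i) p P := by simp_rw [eLpNorm_norm]

lemma tendstoInDistribution_of_tendsto_eLpNorm_pi [IsProbabilityMeasure P] [Finite ι]
    {α : Type*} {l : Filter α} [l.IsCountablyGenerated] {X : α → Ω → ι → ℝ} {Y : Ω → ι → ℝ}
    (hX : ∀ a, AEMeasurable (X a) P) (hY : AEMeasurable Y P) {p : ℝ≥0∞} (hp : 1 ≤ p)
    (hlim : ∀ i, Tendsto (fun a => eLpNorm (fun ω => X a ω i - Y ω i) p P) l (𝓝 0)) :
    TendstoInDistribution X l Y (fun _ => P) P := by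
  have := Fintype.ofFinite ι
  have hsum : Tendsto (fun a => ∑ i, eLpNorm (fun ω => X a ω i - Y ω i) p P) l (𝓝 0) := by
    simpa using tendsto_finsetSum Finset.univ fun i _ => hlim i
  have hnorm : Tendsto (fun a => eLpNorm (X a - Y) p P) l (𝓝 0) :=
    tendsto_of_tendsto_of_tendsto_of_le_of_le tendsto_const_nhds hsum (fun _ => zero_le)
      fun a => eLpNorm_pi_le_sum
        (fun i => (((hX a).eval i).sub (hY.eval i)).aestronglyMeasurable) hp
  exact (tendstoInMeasure_of_tendsto_eLpNorm (zero_lt_one.trans_le hp).ne'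
    (fun a => (hX a).aestronglyMeasurable) hY.aestronglyMeasurable
    hnorm).tendstoInDistribution_of_aemeasurable hX hY

end RandomVector

section IdenticalDistribution

variable {Ω Ω' : Type*} [MeasurableSpace Ω] [MeasurableSpace Ω'] {P : Measure Ω} {P' : Measure Ω'}
  {F F' : Measure ℝ} {Z : Set ℝ → Ω → ℂ} {Z' : Set ℝ → Ω' → ℂ}

lemma IsStochIntegral.const_mul (hZ : IsGaussianRandomMeasure F Z P) (c : ℂ) {g : ℝ → ℂ}
    {X : Ω → ℂ} (hX : IsStochIntegral F Z P g X) :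
    IsStochIntegral F Z P (fun l => c * g l) (fun ω => c * X ω) := by
  have hY := isStochIntegral_stochIntegral hZ (hX.1.const_mul c)
  refine hY.congr_ae ?_
  simpa using IsStochIntegral.ae_eq_sum hZ (fun _ : Unit => hX) hY (c := fun _ => c) (by simp)

lemma IsStochIntegral.identDistrib_re [F.IsNegInvariant] [F'.IsNegInvariant]
    (hZ : IsGaussianRandomMeasure F Z P) (hZ' : IsGaussianRandomMeasure F' Z' P') {ι : Type*}
    [Finite ι] {g h : ι → ℝ → ℂ} {X : ι → Ω → ℂ} {Y : ι → Ω' → ℂ}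
    (hX : ∀ i, IsStochIntegral F Z P (g i) (X i)) (hY : ∀ i, IsStochIntegral F' Z' P' (h i) (Y i))
    (hg : ∀ i l, g i (-l) = (starRingEnd ℂ) (g i l))
    (hh : ∀ i l, h i (-l) = (starRingEnd ℂ) (h i l))
    (hgh : ∀ i j, ∫ l, g i l * (starRingEnd ℂ) (g j l) ∂F =
      ∫ l, h i l * (starRingEnd ℂ) (h j l) ∂F') :
    IdentDistrib (fun ω i => (X i ω).re) (fun ω i => (Y i ω).re) P P' := by
  refine identDistrib_of_hasGaussianLaw (IsStochIntegral.hasGaussianLaw_re_pi hZ hX)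
    (IsStochIntegral.hasGaussianLaw_re_pi hZ' hY) (fun i => ?_) fun i j => ?_
  · rw [(hX i).integral_re hZ, (hY i).integral_re hZ']
  · rw [← Complex.ofReal_inj, (hX i).covariance_re hZ (hX j) (hg i) (hg j),
      (hY i).covariance_re hZ' (hY j) (hh i) (hh j), hgh]

end IdenticalDistribution

section KernelInnerProduct

lemma heatKernelFourier_mul_conj (μ t x t' x' l : ℝ) :
    heatKernelFourier μ t x l * (starRingEnd ℂ) (heatKernelFourier μ t' x' l) =
      heatKernelFourier μ (t + t') (x - x') l := by
  simp only [heatKernelFourier, ← Complex.exp_conj, ← Complex.exp_add]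
  congr 1
  simp
  ring

lemma integral_heatKernelFourier {μ t : ℝ} (hμt : 0 < μ * t) (x : ℝ) :
    ∫ l, heatKernelFourier μ t x l =
      ((√(Real.pi / (μ * t)) * Real.exp (-x ^ 2 / (4 * μ * t)) : ℝ) : ℂ) := by
  have hgauss := fourierIntegral_gaussian (b := (μ * t : ℝ)) (by rwa [Complex.ofReal_re]) (x : ℂ)
  have hkernel (l : ℝ) : heatKernelFourier μ t x l =
      Complex.exp (Complex.I * x * l) * Complex.exp (-(μ * t : ℝ) * l ^ 2) := by
    rw [heatKernelFourier, ← Complex.exp_add]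
    congr 1
    push_cast
    ring
  simp_rw [hkernel]
  rw [hgauss, Real.sqrt_eq_rpow, Complex.ofReal_mul (_ ^ _), Complex.ofReal_cpow (by positivity),
    mul_assoc 4]
  push_cast
  rfl

lemma integral_scaledHeatKernel_zero_mul_conj {f : ℝ → ℝ} (hf0 : 0 ≤ f 0) {μ t t' : ℝ}
    (hμt : 0 < μ * (t + t')) (x x' : ℝ) :
    ∫ l, scaledHeatKernel f μ 0 t x l * (starRingEnd ℂ) (scaledHeatKernel f μ 0 t' x' l) =
      ((f 0 * (√(Real.pi / (μ * (t + t'))) *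
        Real.exp (-(x - x') ^ 2 / (4 * μ * (t + t')))) : ℝ) : ℂ) := by
  have hkernel (l : ℝ) :
      scaledHeatKernel f μ 0 t x l * (starRingEnd ℂ) (scaledHeatKernel f μ 0 t' x' l) =
        heatKernelFourier μ (t + t') (x - x') l * f 0 := by
    rw [scaledHeatKernel_zero, scaledHeatKernel_zero, map_mul, Complex.conj_ofReal,
      mul_mul_mul_comm, heatKernelFourier_mul_conj, ← Complex.ofReal_mul, Real.mul_self_sqrt hf0]
  simp_rw [hkernel]
  rw [integral_mul_const, integral_heatKernelFourier hμt, ← Complex.ofReal_mul, mul_comm]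

lemma heatKernelFourier_scale {ε : ℝ} (hε : 0 < ε) (μ t x l : ℝ) :
    heatKernelFourier μ (t / ε) (x / √ε) (l * √ε) = heatKernelFourier μ t x l := by
  have hsqrt : ((√ε : ℝ) : ℂ) ≠ 0 := by exact_mod_cast (Real.sqrt_pos.2 hε).ne'
  have hsq : (ε : ℂ) = ((√ε : ℝ) : ℂ) ^ 2 := by exact_mod_cast (Real.sq_sqrt hε.le).symm
  rw [heatKernelFourier, heatKernelFourier]
  congr 1
  push_cast
  rw [hsq]
  field_simp

lemma rpow_neg_fourth_mul_self {ε : ℝ} (hε : 0 < ε) :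
    ε ^ (-(1 / 4) : ℝ) * ε ^ (-(1 / 4) : ℝ) = |(√ε)⁻¹| := by
  rw [abs_of_pos (inv_pos.2 (Real.sqrt_pos.2 hε)), ← Real.rpow_add hε, Real.sqrt_eq_rpow,
    ← Real.rpow_neg hε.le]
  norm_num

lemma integral_rescaled_mul_conj {f : ℝ → ℝ} (hf : AEMeasurable f) (hf0 : 0 ≤ᵐ[volume] f) {ε : ℝ}
    (hε : 0 < ε) (μ t x t' x' : ℝ) :
    ∫ l, (ε ^ (-(1 / 4) : ℝ) : ℝ) * heatKernelFourier μ (t / ε) (x / √ε) l *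
        (starRingEnd ℂ) ((ε ^ (-(1 / 4) : ℝ) : ℝ) * heatKernelFourier μ (t' / ε) (x' / √ε) l)
        ∂(volume.withDensity fun l => ENNReal.ofReal (f l)) =
      ∫ l, scaledHeatKernel f μ ε t x l * (starRingEnd ℂ) (scaledHeatKernel f μ ε t' x' l) := by
  have hchange := Measure.integral_comp_mul_right (fun l : ℝ => (f l : ℂ) *
    (heatKernelFourier μ (t / ε) (x / √ε) l *
      (starRingEnd ℂ) (heatKernelFourier μ (t' / ε) (x' / √ε) l))) (√ε)
  have hscaled : ∀ᵐ l : ℝ, 0 ≤ f (l * √ε) := by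
    simpa [mul_comm] using
      (Measure.quasiMeasurePreserving_smul volume (Real.sqrt_pos.2 hε).ne').ae hf0
  simp_rw [map_mul, Complex.conj_ofReal, mul_mul_mul_comm, ← Complex.ofReal_mul,
    rpow_neg_fourth_mul_self hε]
  rw [integral_const_mul, integral_withDensity_ofReal hf hf0, ← Complex.real_smul, ← hchange]
  refine integral_congr_ae ?_
  filter_upwards [hscaled] with l hl
  rw [heatKernelFourier_scale hε, heatKernelFourier_scale hε, scaledHeatKernel, scaledHeatKernel,
    map_mul, Complex.conj_ofReal, mul_mul_mul_comm, ← Complex.ofReal_mul, Real.mul_self_sqrt hl,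
    mul_comm]

end KernelInnerProduct

section Fields

variable {Ω Ω' : Type*} [MeasurableSpace Ω] [MeasurableSpace Ω'] {P : Measure Ω} {P' : Measure Ω'}
  {F : Measure ℝ} {Z : Set ℝ → Ω → ℂ} {W : Set ℝ → Ω' → ℂ} {κ w μ : ℝ}

lemma solutionC_eq_solution [IsFiniteMeasure F] (hZ : IsGaussianRandomMeasure F Z P) {t : ℝ}
    (hμt : 0 ≤ μ * t) (x : ℝ) :
    ∀ᵐ ω ∂P, solutionC F Z P μ t x ω = (solution F Z P μ t x ω : ℂ) := by
  have := hZ.isNegInvariant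
  exact (isStochIntegral_stochIntegral hZ
    (memLp_heatKernelFourier_of_isFiniteMeasure hμt x)).eq_ofReal_re hZ
    (heatKernelFourier_neg μ t x)

lemma isStochIntegral_limitFieldC (hW : IsWhiteNoise W P') (κ w : ℝ) {t : ℝ} (hμt : 0 < μ * t)
    (x : ℝ) : IsStochIntegral volume W P' (scaledHeatKernel (specDensity κ w) μ 0 t x)
      (limitFieldC W P' κ w μ t x) := by
  simp_rw [scaledHeatKernel_zero, specDensity_zero, mul_comm (heatKernelFourier μ t x _)]
  exact (isStochIntegral_stochIntegral hW (memLp_heatKernelFourier hμt x)).const_mul hW _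

lemma scaledHeatKernel_specDensity_neg (κ w μ ε t x l : ℝ) :
    scaledHeatKernel (specDensity κ w) μ ε t x (-l) =
      (starRingEnd ℂ) (scaledHeatKernel (specDensity κ w) μ ε t x l) :=
  scaledHeatKernel_neg (specDensity_neg κ w) μ ε t x l

lemma limitFieldC_eq_limitField (hW : IsWhiteNoise W P') (κ w : ℝ) {t : ℝ} (hμt : 0 < μ * t)
    (x : ℝ) : ∀ᵐ ω ∂P', limitFieldC W P' κ w μ t x ω = (limitField W P' κ w μ t x ω : ℂ) :=
  (isStochIntegral_limitFieldC hW κ w hμt x).eq_ofReal_re hW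
    (scaledHeatKernel_specDensity_neg κ w μ 0 t x)

lemma isGaussianProcess_limitField (hW : IsWhiteNoise W P') (hμ : 0 < μ) (κ w : ℝ) :
    IsGaussianProcess (fun p : Set.Ioi (0 : ℝ) × ℝ => limitField W P' κ w μ p.1 p.2) P' :=
  ⟨fun I => IsStochIntegral.hasGaussianLaw_re_pi hW fun p : I =>
    isStochIntegral_limitFieldC hW κ w (mul_pos hμ p.1.1.2) p.1.2⟩

lemma integral_limitField (hW : IsWhiteNoise W P') (κ w : ℝ) {t : ℝ} (hμt : 0 < μ * t) (x : ℝ) :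
    ∫ ω, limitField W P' κ w μ t x ω ∂P' = 0 :=
  (isStochIntegral_limitFieldC hW κ w hμt x).integral_re hW

lemma covariance_limitField (hW : IsWhiteNoise W P') (hκ : 0 < κ) (hodd : ∀ n : ℕ, κ ≠ 2 * n + 1)
    (hw : w ≠ 0) (hμ : 0 < μ) {t t' : ℝ} (ht : 0 < t) (ht' : 0 < t') (x x' : ℝ) :
    cov[limitField W P' κ w μ t x, limitField W P' κ w μ t' x'; P'] =
      cTwo κ * √Real.pi * (1 - theta κ |w|) / (√μ * |w| ^ (1 - κ)) *
        (Real.exp (-(x - x') ^ 2 / (4 * μ * (t + t'))) / √(t + t')) := by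
  have hcov := (isStochIntegral_limitFieldC hW κ w (mul_pos hμ ht) x).covariance_re hW
    (isStochIntegral_limitFieldC hW κ w (mul_pos hμ ht') x')
    (scaledHeatKernel_specDensity_neg κ w μ 0 t x) (scaledHeatKernel_specDensity_neg κ w μ 0 t' x')
  rw [integral_scaledHeatKernel_zero_mul_conj (specDensity_zero_pos hκ hodd hw).le
    (mul_pos hμ (add_pos ht ht')), Complex.ofReal_inj, specDensity_zero,
    Real.sqrt_div Real.pi_pos.le, Real.sqrt_mul hμ.le] at hcov
  refine hcov.trans ?_
  ring

lemma stationaryInSpace_limitField (hW : IsWhiteNoise W P') (hκ : 0 < κ)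
    (hodd : ∀ n : ℕ, κ ≠ 2 * n + 1) (hw : w ≠ 0) (hμ : 0 < μ) :
    StationaryInSpace (limitField W P' κ w μ) P' := fun h n t x ht =>
  IsStochIntegral.identDistrib_re hW hW
    (fun i => isStochIntegral_limitFieldC hW κ w (mul_pos hμ (ht i)) (x i + h))
    (fun i => isStochIntegral_limitFieldC hW κ w (mul_pos hμ (ht i)) (x i))
    (fun i => scaledHeatKernel_specDensity_neg κ w μ 0 (t i) (x i + h))
    (fun i => scaledHeatKernel_specDensity_neg κ w μ 0 (t i) (x i))
    fun i j => by
      have hμt : 0 < μ * (t i + t j) := mul_pos hμ (add_pos (ht i) (ht j))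
      have hf0 := (specDensity_zero_pos hκ hodd hw).le
      rw [integral_scaledHeatKernel_zero_mul_conj hf0 hμt,
        integral_scaledHeatKernel_zero_mul_conj hf0 hμt, add_sub_add_right_eq_sub]

lemma variance_limitField (hW : IsWhiteNoise W P') (hκ : 0 < κ) (hodd : ∀ n : ℕ, κ ≠ 2 * n + 1)
    (hw : w ≠ 0) (hμ : 0 < μ) {t : ℝ} (ht : 0 < t) (x : ℝ) :
    Var[limitField W P' κ w μ t x; P'] = specDensity κ w 0 * √(Real.pi / μ) / √(t + t) := by
  have hmeas := (isGaussianProcess_limitField hW hμ κ w).aemeasurable (⟨t, ht⟩, x)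
  rw [← covariance_self hmeas, covariance_limitField hW hκ hodd hw hμ ht ht, sub_self,
    zero_pow two_ne_zero, neg_zero, zero_div, Real.exp_zero, specDensity_zero,
    Real.sqrt_div Real.pi_pos.le]
  ring

lemma not_stationaryInTime_limitField (hW : IsWhiteNoise W P') (hκ : 0 < κ)
    (hodd : ∀ n : ℕ, κ ≠ 2 * n + 1) (hw : w ≠ 0) (hμ : 0 < μ) :
    ¬ StationaryInTime (limitField W P' κ w μ) P' := by
  intro hstat
  have hident := (hstat 1 one_pos 1 (fun _ => 1) (fun _ => 0) fun _ => one_pos).comp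
    (measurable_pi_apply 0)
  have hvar : Var[limitField W P' κ w μ (1 + 1) 0; P'] = Var[limitField W P' κ w μ 1 0; P'] :=
    hident.variance_eq
  rw [variance_limitField hW hκ hodd hw hμ (by norm_num),
    variance_limitField hW hκ hodd hw hμ one_pos] at hvar
  have hpos : 0 < specDensity κ w 0 * √(Real.pi / μ) :=
    mul_pos (specDensity_zero_pos hκ hodd hw) (Real.sqrt_pos.2 (div_pos Real.pi_pos hμ))
  have hlt : √(1 + 1 : ℝ) < √(1 + 1 + (1 + 1)) := Real.sqrt_lt_sqrt (by norm_num) (by norm_num)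
  exact (div_lt_div_of_pos_left hpos (by positivity) hlt).ne hvar

lemma isStochIntegral_coupledFieldC (hW : IsWhiteNoise W P') (hκ : 0 < κ)
    (hodd : ∀ n : ℕ, κ ≠ 2 * n + 1) (w : ℝ) {ε t : ℝ} (hε : 0 ≤ ε) (hμt : 0 < μ * t) (x : ℝ) :
    IsStochIntegral volume W P' (scaledHeatKernel (specDensity κ w) μ ε t x)
      (coupledFieldC W P' κ w μ ε t x) :=
  isStochIntegral_stochIntegral hW
    (memLp_scaledHeatKernel (integrable_specDensity hκ hodd w) hμt hε x)

lemma coupledFieldC_eq_coupledField (hW : IsWhiteNoise W P') (hκ : 0 < κ)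
    (hodd : ∀ n : ℕ, κ ≠ 2 * n + 1) (w : ℝ) {ε t : ℝ} (hε : 0 ≤ ε) (hμt : 0 < μ * t) (x : ℝ) :
    ∀ᵐ ω ∂P', coupledFieldC W P' κ w μ ε t x ω = (coupledField W P' κ w μ ε t x ω : ℂ) :=
  (isStochIntegral_coupledFieldC hW hκ hodd w hε hμt x).eq_ofReal_re hW
    (scaledHeatKernel_specDensity_neg κ w μ ε t x)

lemma tendsto_eLpNorm_coupledField_sub (hW : IsWhiteNoise W P') (hκ : 0 < κ)
    (hodd : ∀ n : ℕ, κ ≠ 2 * n + 1) (hw : w ≠ 0) {t : ℝ} (hμt : 0 < μ * t) (x : ℝ) :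
    Tendsto (fun ε : ℝ => eLpNorm
      (fun ω => coupledField W P' κ w μ ε t x ω - limitField W P' κ w μ t x ω) 2 P')
      (𝓝[>] 0) (𝓝 0) := by
  refine tendsto_of_tendsto_of_tendsto_of_le_of_le' tendsto_const_nhds
    (tendsto_eLpNorm_scaledHeatKernel_sub (integrable_specDensity hκ hodd w)
      (continuousAt_specDensity_zero hκ hodd hw) hμt x) (.of_forall fun _ => zero_le) ?_
  filter_upwards [self_mem_nhdsWithin] with ε hε
  rw [← (isStochIntegral_coupledFieldC hW hκ hodd w (le_of_lt hε) hμt x).eLpNorm_sub hW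
    (isStochIntegral_limitFieldC hW κ w hμt x)]
  refine eLpNorm_mono fun ω => ?_
  rw [coupledField, limitField, ← Complex.sub_re]
  exact Complex.abs_re_le_norm _

lemma isStochIntegral_rescaled [IsFiniteMeasure F] (hZ : IsGaussianRandomMeasure F Z P) {ε t : ℝ}
    (hμt : 0 ≤ μ * (t / ε)) (x : ℝ) :
    IsStochIntegral F Z P
      (fun l => (ε ^ (-(1 / 4) : ℝ) : ℝ) * heatKernelFourier μ (t / ε) (x / √ε) l)
      (fun ω => (ε ^ (-(1 / 4) : ℝ) : ℝ) * solutionC F Z P μ (t / ε) (x / √ε) ω) :=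
  (isStochIntegral_stochIntegral hZ
    (memLp_heatKernelFourier_of_isFiniteMeasure hμt (x / √ε))).const_mul hZ _

lemma sameFdd_rescaled_coupledField [IsFiniteMeasure F] (hZ : IsGaussianRandomMeasure F Z P)
    (hF : F = volume.withDensity fun l => ENNReal.ofReal (specDensity κ w l))
    (hW : IsWhiteNoise W P') (hκ : 0 < κ) (hodd : ∀ n : ℕ, κ ≠ 2 * n + 1) (hμ : 0 < μ) {ε : ℝ}
    (hε : 0 < ε) : SameFdd (rescaled F Z P μ ε) P (coupledField W P' κ w μ ε) P' := by
  intro n t x ht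
  have := hZ.isNegInvariant
  have hident := IsStochIntegral.identDistrib_re hZ hW
    (fun i => isStochIntegral_rescaled hZ (mul_pos hμ (div_pos (ht i) hε)).le (x i))
    (fun i => isStochIntegral_coupledFieldC hW hκ hodd w hε.le (mul_pos hμ (ht i)) (x i))
    (fun i l => by rw [heatKernelFourier_neg, map_mul, Complex.conj_ofReal])
    (fun i => scaledHeatKernel_specDensity_neg κ w μ ε (t i) (x i))
    fun i j => by
      rw [hF, integral_rescaled_mul_conj (integrable_specDensity hκ hodd w).aemeasurable
        (specDensity_nonneg_ae hκ hodd w) hε]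
  simp_rw [Complex.re_ofReal_mul] at hident
  exact hident

lemma fddTendsto_rescaled [IsProbabilityMeasure P] [IsProbabilityMeasure P'] [IsFiniteMeasure F]
    (hZ : IsGaussianRandomMeasure F Z P)
    (hF : F = volume.withDensity fun l => ENNReal.ofReal (specDensity κ w l))
    (hW : IsWhiteNoise W P') (hκ : 0 < κ) (hodd : ∀ n : ℕ, κ ≠ 2 * n + 1) (hw : w ≠ 0)
    (hμ : 0 < μ) : FddTendsto (rescaled F Z P μ) P (limitField W P' κ w μ) P' := by
  intro n t x ht
  have hsame (ε : Set.Ioi (0 : ℝ)) :=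
    sameFdd_rescaled_coupledField hZ hF hW hκ hodd hμ ε.2 n t x ht
  have hlimit : AEMeasurable (fieldAt (limitField W P' κ w μ) t x) P' :=
    (IsStochIntegral.hasGaussianLaw_re_pi hW fun i =>
      isStochIntegral_limitFieldC hW κ w (mul_pos hμ (ht i)) (x i)).aemeasurable
  have hfilter : Tendsto ((↑) : Set.Ioi (0 : ℝ) → ℝ) (comap Subtype.val (𝓝 0)) (𝓝[>] 0) :=
    tendsto_nhdsWithin_iff.2 ⟨tendsto_comap, .of_forall fun ε => ε.2⟩
  have hcoupled := tendstoInDistribution_of_tendsto_eLpNorm_pi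
    (fun ε => (hsame ε).aemeasurable_snd) hlimit one_le_two fun i =>
      (tendsto_eLpNorm_coupledField_sub hW hκ hodd hw (mul_pos hμ (ht i)) (x i)).comp hfilter
  exact ⟨fun ε => (hsame ε).aemeasurable_fst, hlimit,
    hcoupled.tendsto.congr fun ε => Subtype.ext (hsame ε).map_eq.symm⟩

end Fields

theorem theorem3_general {Ω Ω' : Type*} [MeasurableSpace Ω] [MeasurableSpace Ω']
    (P : Measure Ω) [IsProbabilityMeasure P] (P' : Measure Ω') [IsProbabilityMeasure P']
    (μ κ w : ℝ) (hμ : 0 < μ) (hκ : 0 < κ) (hodd : ∀ n : ℕ, κ ≠ 2 * n + 1) (hw : w ≠ 0)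
    (F : Measure ℝ) [IsFiniteMeasure F] (Z : Set ℝ → Ω → ℂ) (hZ : IsGaussianRandomMeasure F Z P)
    (η : ℝ → Ω → ℝ)
    (hη : ∀ x : ℝ, ∀ᵐ ω ∂P,
      (η x ω : ℂ) = stochIntegral F Z P (fun l => Complex.exp (Complex.I * l * x)) ω)
    (hcov : ∀ x : ℝ, cov[η 0, η x; P] = Real.cos (w * x) / (1 + x ^ 2) ^ (κ / 2))
    (W : Set ℝ → Ω' → ℂ) (hW : IsWhiteNoise W P') :
    (∀ t x : ℝ, 0 < t → ∀ᵐ ω ∂P, solutionC F Z P μ t x ω = (solution F Z P μ t x ω : ℂ)) ∧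
    (Measurable (Function.uncurry η) → ∀ t x : ℝ, 0 < t → ∀ᵐ ω ∂P,
      Integrable (fun y => η y ω * Real.exp (-(x - y) ^ 2 / (4 * μ * t))) ∧
      solution F Z P μ t x ω =
        1 / √(4 * Real.pi * μ * t) * ∫ y, η y ω * Real.exp (-(x - y) ^ 2 / (4 * μ * t))) ∧
    (∀ t x : ℝ, 0 < t →
      ∀ᵐ ω ∂P', limitFieldC W P' κ w μ t x ω = (limitField W P' κ w μ t x ω : ℂ)) ∧
    IsGaussianProcess (fun p : Set.Ioi (0 : ℝ) × ℝ => limitField W P' κ w μ p.1 p.2) P' ∧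
    (∀ t x : ℝ, 0 < t → ∫ ω, limitField W P' κ w μ t x ω ∂P' = 0) ∧
    (∀ t x t' x' : ℝ, 0 < t → 0 < t' →
      cov[limitField W P' κ w μ t x, limitField W P' κ w μ t' x'; P'] =
        cTwo κ * √Real.pi * (1 - theta κ |w|) / (√μ * |w| ^ (1 - κ)) *
          (Real.exp (-(x - x') ^ 2 / (4 * μ * (t + t'))) / √(t + t'))) ∧
    FddTendsto (rescaled F Z P μ) P (limitField W P' κ w μ) P' ∧
    (∀ ε : ℝ, 0 < ε →
      (∀ t x : ℝ, 0 < t → ∀ᵐ ω ∂P',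
        coupledFieldC W P' κ w μ ε t x ω = (coupledField W P' κ w μ ε t x ω : ℂ)) ∧
      SameFdd (rescaled F Z P μ ε) P (coupledField W P' κ w μ ε) P') ∧
    (∀ t x : ℝ, 0 < t →
      Tendsto (fun ε : ℝ => eLpNorm
        (fun ω => coupledField W P' κ w μ ε t x ω - limitField W P' κ w μ t x ω) 2 P')
        (𝓝[>] 0) (𝓝 0)) ∧
    StationaryInSpace (limitField W P' κ w μ) P' ∧
    ¬ StationaryInTime (limitField W P' κ w μ) P' := by
  have hη' (x : ℝ) : IsStochIntegral F Z P (heatKernelFourier 0 0 x) fun ω => (η x ω : ℂ) := by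
    refine (isStochIntegral_stochIntegral hZ
      (memLp_heatKernelFourier_of_isFiniteMeasure (by simp) x)).congr_ae ?_
    rw [heatKernelFourier_time_zero]
    exact EventuallyEq.symm (hη x)
  have hF := controlMeasure_eq_withDensity_specDensity hZ hκ hodd hη' hcov
  exact ⟨fun t x ht => solutionC_eq_solution hZ (mul_pos hμ ht).le x,
    fun hηm t x ht => solution_eq_heatSemigroup hZ hη' hηm (mul_pos hμ ht) x,
    fun t x ht => limitFieldC_eq_limitField hW κ w (mul_pos hμ ht) x,
    isGaussianProcess_limitField hW hμ κ w,
    fun t x ht => integral_limitField hW κ w (mul_pos hμ ht) x,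
    fun t x t' x' ht ht' => covariance_limitField hW hκ hodd hw hμ ht ht' x x',
    fddTendsto_rescaled hZ hF hW hκ hodd hw hμ,
    fun ε hε => ⟨fun t x ht => coupledFieldC_eq_coupledField hW hκ hodd w hε.le (mul_pos hμ ht) x,
      sameFdd_rescaled_coupledField hZ hF hW hκ hodd hμ hε⟩,
    fun t x ht => tendsto_eLpNorm_coupledField_sub hW hκ hodd hw (mul_pos hμ ht) x,
    stationaryInSpace_limitField hW hκ hodd hw hμ,
    not_stationaryInTime_limitField hW hκ hodd hw hμ⟩

theorem theorem3 {Ω Ω' : Type*} [MeasurableSpace Ω] [MeasurableSpace Ω']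
    (P : Measure Ω) [IsProbabilityMeasure P] (P' : Measure Ω') [IsProbabilityMeasure P']
    (μ κ w : ℝ) (hμ : 0 < μ) (hκ₀ : 0 < κ) (hκ₁ : κ < 1) (hw : w ≠ 0)
    -- the initial condition `η(x) = ∫ exp(i l x) Z(dl)`, with `E |Z(dl)|² = F(dl)`
    (F : Measure ℝ) [IsFiniteMeasure F] (Z : Set ℝ → Ω → ℂ) (hZ : IsGaussianRandomMeasure F Z P)
    (η : ℝ → Ω → ℝ)
    (hη : ∀ x : ℝ, ∀ᵐ ω ∂P,
      (η x ω : ℂ) = stochIntegral F Z P (fun l => Complex.exp (Complex.I * l * x)) ω)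
    (hcov : ∀ x : ℝ, cov[η 0, η x; P] = Real.cos (w * x) / (1 + x ^ 2) ^ (κ / 2))
    -- the white noise of the limit field
    (W : Set ℝ → Ω' → ℂ) (hW : IsWhiteNoise W P') :
    -- the solution is real, and it is the heat semigroup applied to the initial condition
    (∀ t x : ℝ, 0 < t → ∀ᵐ ω ∂P, solutionC F Z P μ t x ω = (solution F Z P μ t x ω : ℂ)) ∧
    (Measurable (Function.uncurry η) → ∀ t x : ℝ, 0 < t → ∀ᵐ ω ∂P,
      Integrable (fun y => η y ω * Real.exp (-(x - y) ^ 2 / (4 * μ * t))) ∧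
      solution F Z P μ t x ω =
        1 / √(4 * Real.pi * μ * t) * ∫ y, η y ω * Real.exp (-(x - y) ^ 2 / (4 * μ * t))) ∧
    -- the limit is a real zero-mean Gaussian field with the stated covariance function
    (∀ t x : ℝ, 0 < t →
      ∀ᵐ ω ∂P', limitFieldC W P' κ w μ t x ω = (limitField W P' κ w μ t x ω : ℂ)) ∧
    IsGaussianProcess (fun p : Set.Ioi (0 : ℝ) × ℝ => limitField W P' κ w μ p.1 p.2) P' ∧
    (∀ t x : ℝ, 0 < t → ∫ ω, limitField W P' κ w μ t x ω ∂P' = 0) ∧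
    (∀ t x t' x' : ℝ, 0 < t → 0 < t' →
      cov[limitField W P' κ w μ t x, limitField W P' κ w μ t' x'; P'] =
        cTwo κ * √Real.pi * (1 - theta κ |w|) / (√μ * |w| ^ (1 - κ)) *
          (Real.exp (-(x - x') ^ 2 / (4 * μ * (t + t'))) / √(t + t'))) ∧
    -- convergence of the finite-dimensional distributions
    FddTendsto (rescaled F Z P μ) P (limitField W P' κ w μ) P' ∧
    -- mean-square convergence of versions of the rescaled solutions
    (∀ ε : ℝ, 0 < ε →
      (∀ t x : ℝ, 0 < t → ∀ᵐ ω ∂P',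
        coupledFieldC W P' κ w μ ε t x ω = (coupledField W P' κ w μ ε t x ω : ℂ)) ∧
      SameFdd (rescaled F Z P μ ε) P (coupledField W P' κ w μ ε) P') ∧
    (∀ t x : ℝ, 0 < t →
      Tendsto (fun ε : ℝ => eLpNorm
        (fun ω => coupledField W P' κ w μ ε t x ω - limitField W P' κ w μ t x ω) 2 P')
        (𝓝[>] 0) (𝓝 0)) ∧
    -- the limit field is stationary in space but not in time
    StationaryInSpace (limitField W P' κ w μ) P' ∧
    ¬ StationaryInTime (limitField W P' κ w μ) P' :=
  theorem3_general P P' μ κ w hμ hκ₀ (fun n => (hκ₁.trans_le (by simp)).ne) hw F Z hZ η hη hcov W hW
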